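/- For every $\delta > 0$ there is a constant $c = c(\delta) > 0$ such that the following holds. Let $p \ge 3$ be a prime and let $A \subset \mathbb{Z}/p\mathbb{Z}$ satisfy $\delta \le |A|/p \le 1-\delta$. Then $$\|\chi_A\|_{A(\mathbb{Z}/p\mathbb{Z})} \ \ge\ c\left(\frac{\log p}{(\log\log p)^3}\right)^{1/2}.$$ Here $\chi_A$ is the indicator function of $A$ and, for $f : \mathbb{Z}/p\mathbb{Z} \to \mathbb{C}$, $$\|f\|_{A(\mathbb{Z}/p\mathbb{Z})} := \sum_{\gamma} |\widehat{f}(\gamma)|, \qquad \widehat{f}(\gamma) := \frac1p \sum_{x \in \mathbb{Z}/p\mathbb{Z}} f(x)\overline{\gamma(x)},$$ where $\gamma$ runs over all characters of $\mathbb{Z}/p\mathbb{Z}$, that is, all homomorphisms from $\mathbb{Z}/p\mathbb{Z}$ to the unit circle $\{z\in\mathbb{C}: |z|=1\}$. -/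

import Mathlib

noncomputable section

/-- The Fourier transform on a finite (discrete) abelian group `G`, with respect to the Haar
probability measure on `G`, i.e. the normalised counting measure:
`f̂(γ) = |G|⁻¹ ∑ x, f x * conj (γ x)`. The dual group of `G` is `AddChar G ℂ`: as `G` is finite,
every homomorphism from `G` to the multiplicative group of `ℂ` is continuous and takes values in
the unit circle (see `AddChar.circleEquivComplex`). -/
def fourierCoeffFin {G : Type*} [AddCommGroup G] [Fintype G] (f : G → ℂ)
    (γ : AddChar G ℂ) : ℂ :=
  (Fintype.card G : ℂ)⁻¹ * ∑ x : G, f x * (starRingEnd ℂ) (γ x)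

/-- The `A(G)`-norm of a function on a finite abelian group: the `ℓ¹`-norm of its Fourier
transform over the (finite) dual group. -/
def wienerNorm {G : Type*} [AddCommGroup G] [Fintype G] (f : G → ℂ) : ℝ :=
  ∑ γ : AddChar G ℂ, ‖fourierCoeffFin f γ‖

end

/-!
Let `f` be the indicator function of `A`, let `M` be its `A(ℤ/p)`-norm and `L = log p`. The bound
is proved in the form `L ≤ C(δ) * M ^ 2 * (log L) ^ 3`, where one may assume `M ≤ L`.

The idea is to run an iteration in which each step exhibits new Fourier mass of `f`, so that the
total mass `M` limits the number of steps, and to see that a small `M` would leave too few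
frequencies in play to stop the iteration. A scale is described by a seminorm `ρ` on the group,
dominated by `W * ∑ χ ∈ Γ, |1 - χ(t)|` for a finite set `Γ` of characters. The usual Bohr set `{ρ
≤ 1}` is replaced by the weight `gibbs ρ`, proportional to `exp (-ρ)`; translation by `t` changes
it by a factor at most `exp (ρ t)`, and this makes regularity of Bohr sets unnecessary. A
character is captured by `ρ` if `|1 - χ(t)| ≤ ρ(t)` for all `t`.

As long as `ρ` is tiny at some nonzero point, averages of `f` along multiples of that point change
slowly, so by a discrete intermediate value argument some translate of the Gibbs weight gives `f`
an average away from `0` and `1` (`exists_gibbs_average_mem`). Then `f` differs from its translate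
by some `t` with respect to a weight `μ` of the same scale (`exists_tempered_le_sum_mul_sub`).
Expanding `f(y) - f(y + t)` in characters shows that the uncaptured characters `γ`, weighted by
`|f̂(γ)|`, have correlation bounded below on average with `f` under `μ` (`le_sum_compl_captured`).
Dyadic pigeonholing (`exists_level`) selects the uncaptured characters with correlation at least
`2 ^ (-i - 1)` for some `i`; their mass `g` is at least a constant and at least a constant times
`2 ^ i / log L`.

The set so obtained is captured by a multiple of `ρ` and few further characters. This is a
Chang-type theorem for functions of small `A(G)`-norm (`exists_card_le_and_charSeminorm_le`): a
dissociated subset of it has only `O(2 ^ i * log L)` elements. The proof pairs `f` with the Riesz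
products `∏ (1 + z * Re (c_χ χ))`. The result is an entire function of `z` which is `O(1)` on
`[-1, 1]` and `O(M)` on the unit disc, hence has derivative `O(log M)` at `0`
(`norm_deriv_zero_le_of_bound`), and this derivative is the sum of the correlations over the
dissociated set (`sum_norm_le_of_dissociated`).

Thus each step gains mass `g`, bounded below by a constant, at the cost of `O(g * (log L) ^ 2)`
new characters and of a factor `L ^ O(1)` in `W` (`exists_capturedMass_increment`). So there are
`O(M)` steps, and always `#Γ = O(M * (log L) ^ 2)` and `log W = O(M * log L)`. Dirichlet's
principle (`exists_ne_zero_charSeminorm_le`) provides the nonzero point needed for the next step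
unless `L = O(#Γ * log W) = O(M ^ 2 * (log L) ^ 3)`.
-/

open Finset

/-! ### Characters as translation-invariant pseudometrics -/

section Characters

variable {G : Type*} [AddCommGroup G] [Fintype G]

theorem norm_one_sub_mul_le {z w : ℂ} (hz : ‖z‖ = 1) :
    ‖1 - z * w‖ ≤ ‖1 - z‖ + ‖1 - w‖ := by
  have h : 1 - z * w = (1 - z) + z * (1 - w) := by ring
  rw [h]
  refine (norm_add_le _ _).trans ?_
  rw [norm_mul, hz, one_mul]

/-- The seminorm `t ↦ |1 - χ(t)|` on `G`, measuring how far `χ` is from being trivial at `t`. -/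
noncomputable def charSeminorm (χ : AddChar G ℂ) : AddGroupSeminorm G where
  toFun t := ‖1 - χ t‖
  map_zero' := by simp
  add_le' s t := by
    rw [AddChar.map_add_eq_mul]
    exact norm_one_sub_mul_le (χ.norm_apply s)
  neg' t := by
    rw [AddChar.map_neg_eq_conj, ← Complex.norm_conj (1 - χ t)]
    simp

theorem charSeminorm_apply (χ : AddChar G ℂ) (t : G) : charSeminorm χ t = ‖1 - χ t‖ := rfl

theorem charSeminorm_nonneg (χ : AddChar G ℂ) (t : G) : 0 ≤ charSeminorm χ t :=
  apply_nonneg _ t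

theorem charSeminorm_le_two (χ : AddChar G ℂ) (t : G) : charSeminorm χ t ≤ 2 := by
  rw [charSeminorm_apply]
  refine (norm_sub_le _ _).trans ?_
  rw [χ.norm_apply, norm_one]
  norm_num

theorem charSeminorm_mul_le (χ ψ : AddChar G ℂ) (t : G) :
    charSeminorm (χ * ψ) t ≤ charSeminorm χ t + charSeminorm ψ t := by
  simp only [charSeminorm_apply, AddChar.mul_apply]
  exact norm_one_sub_mul_le (χ.norm_apply t)

theorem charSeminorm_inv (χ : AddChar G ℂ) (t : G) : charSeminorm χ⁻¹ t = charSeminorm χ t := by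
  rw [charSeminorm_apply, AddChar.inv_apply]
  exact map_neg_eq_map (charSeminorm χ) t

theorem charSeminorm_prod_le (s : Finset (AddChar G ℂ)) (t : G) :
    charSeminorm (∏ χ ∈ s, χ) t ≤ ∑ χ ∈ s, charSeminorm χ t := by
  classical
  induction s using Finset.induction_on with
  | empty => simp [charSeminorm_apply]
  | insert a s ha ih =>
    rw [prod_insert ha, sum_insert ha]
    exact (charSeminorm_mul_le _ _ _).trans (by gcongr)

/-- Fourier inversion on a finite abelian group. -/
theorem sum_fourierCoeffFin_mul (f : G → ℂ) (x : G) :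
    ∑ γ : AddChar G ℂ, fourierCoeffFin f γ * γ x = f x := by
  classical
  have hG : (Fintype.card G : ℂ) ≠ 0 := by simp [Fintype.card_ne_zero]
  calc ∑ γ : AddChar G ℂ, fourierCoeffFin f γ * γ x
      = (Fintype.card G : ℂ)⁻¹ * ∑ y : G, f y * ∑ γ : AddChar G ℂ, γ (x - y) := by
        simp only [fourierCoeffFin, mul_sum, sum_mul]
        rw [sum_comm]
        refine sum_congr rfl fun y _ => sum_congr rfl fun γ _ => ?_
        rw [sub_eq_add_neg, AddChar.map_add_eq_mul, AddChar.map_neg_eq_conj]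
        ring
    _ = f x := by
        simp only [AddChar.sum_apply_eq_ite, sub_eq_zero]
        simp
        field_simp

theorem norm_le_wienerNorm (f : G → ℂ) (x : G) : ‖f x‖ ≤ wienerNorm f := by
  rw [← sum_fourierCoeffFin_mul f x]
  refine (norm_sum_le _ _).trans (le_of_eq (sum_congr rfl fun γ _ => ?_))
  rw [norm_mul, γ.norm_apply, mul_one]

end Characters

/-! ### Weights that vary slowly with respect to a seminorm -/

section Tempered

variable {G : Type*} [AddCommGroup G] [Fintype G]

/-- The Fourier–Stieltjes transform of a real weight on `G`, taken without complex conjugation. -/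
noncomputable def charTransform (μ : G → ℝ) (χ : AddChar G ℂ) : ℂ := ∑ y, (μ y : ℂ) * χ y

/-- A weight is tempered with respect to a seminorm `ρ` if translation by `t` changes it by at most
a factor `exp (ρ t)`. -/
noncomputable def Tempered (ρ : AddGroupSeminorm G) (μ : G → ℝ) : Prop :=
  ∀ x t, μ (x + t) ≤ Real.exp (ρ t) * μ x

/-- The probability weight on `G` proportional to `exp (-ρ)`. It plays the role of the uniform
measure on the Bohr set `{ρ ≤ 1}`, and is tempered without any regularity assumption. -/
noncomputable def gibbs (ρ : AddGroupSeminorm G) (x : G) : ℝ := Real.exp (-ρ x) / ∑ y, Real.exp (-ρ y)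

theorem one_le_sum_exp_neg (ρ : AddGroupSeminorm G) : 1 ≤ ∑ y, Real.exp (-ρ y) := by
  have h := single_le_sum (f := fun y => Real.exp (-ρ y)) (fun y _ => (Real.exp_pos _).le)
    (mem_univ (0 : G))
  simpa using h

theorem gibbs_pos (ρ : AddGroupSeminorm G) (x : G) : 0 < gibbs ρ x :=
  div_pos (Real.exp_pos _) (by linarith [one_le_sum_exp_neg ρ])

theorem gibbs_mem_stdSimplex (ρ : AddGroupSeminorm G) : gibbs ρ ∈ stdSimplex ℝ G := by
  refine ⟨fun x => (gibbs_pos ρ x).le, ?_⟩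
  simp only [gibbs]
  rw [← sum_div]
  exact div_self (by linarith [one_le_sum_exp_neg ρ])

theorem gibbs_neg (ρ : AddGroupSeminorm G) (x : G) : gibbs ρ (-x) = gibbs ρ x := by
  simp only [gibbs, map_neg_eq_map]

theorem gibbs_tempered (ρ : AddGroupSeminorm G) : Tempered ρ (gibbs ρ) := by
  intro x t
  simp only [gibbs]
  rw [← mul_div_assoc, ← Real.exp_add]
  have hZ := one_le_sum_exp_neg ρ
  gcongr
  have h := map_add_le_add ρ (x + t) (-t)
  rw [map_neg_eq_map, add_neg_cancel_right] at h
  linarith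

theorem gibbs_le_exp (ρ : AddGroupSeminorm G) (x : G) : gibbs ρ x ≤ Real.exp (-ρ x) :=
  div_le_self (Real.exp_pos _).le (one_le_sum_exp_neg ρ)

theorem sum_gibbs_tail_le (ρ : AddGroupSeminorm G) (R : ℝ) :
    ∑ x with R < ρ x, gibbs ρ x ≤ Fintype.card G * Real.exp (-R) := by
  calc ∑ x with R < ρ x, gibbs ρ x ≤ ∑ x with R < ρ x, Real.exp (-R) := by
        refine sum_le_sum fun x hx => (gibbs_le_exp ρ x).trans ?_
        have := (mem_filter.1 hx).2
        exact Real.exp_le_exp.2 (by linarith)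
    _ ≤ Fintype.card G * Real.exp (-R) := by
        rw [sum_const, nsmul_eq_mul]
        gcongr
        exact_mod_cast card_le_univ _

omit [Fintype G] in
theorem Tempered.abs_sub_le {ρ : AddGroupSeminorm G} {μ : G → ℝ} (hμ : Tempered ρ μ)
    (x t : G) : |μ (x + t) - μ x| ≤ (Real.exp (ρ t) - 1) * μ x := by
  have h1 := hμ x t
  have h2 := hμ (x + t) (-t)
  rw [map_neg_eq_map, add_neg_cancel_right] at h2
  have h3 : 0 ≤ ρ t := apply_nonneg ρ t
  have h4 := Real.exp_pos (ρ t)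
  have h5 : 1 ≤ Real.exp (ρ t) := Real.one_le_exp h3
  rw [abs_le]
  constructor
  · -- `exp r * μ x ≥ μ (x + t) ≥ exp (-r) * μ x` and `1 - exp (-r) ≤ exp r - 1`
    by_cases h : μ x ≤ μ (x + t)
    · nlinarith
    · nlinarith
  · linarith

theorem Tempered.sum_abs_sub_le {ρ : AddGroupSeminorm G} {μ : G → ℝ} (hμ : Tempered ρ μ)
    (h1 : μ ∈ stdSimplex ℝ G) (t : G) : ∑ y, |μ (y + t) - μ y| ≤ Real.exp (ρ t) - 1 := by
  calc ∑ y, |μ (y + t) - μ y| ≤ ∑ y, (Real.exp (ρ t) - 1) * μ y :=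
        sum_le_sum fun y _ => hμ.abs_sub_le y t
    _ = Real.exp (ρ t) - 1 := by rw [← mul_sum, h1.2, mul_one]

omit [AddCommGroup G] in
theorem sum_abs_sub_le_two {μ ν : G → ℝ} (hμ : μ ∈ stdSimplex ℝ G) (hν : ν ∈ stdSimplex ℝ G) :
    ∑ y, |μ y - ν y| ≤ 2 := by
  calc ∑ y, |μ y - ν y| ≤ ∑ y, (μ y + ν y) := by
        refine sum_le_sum fun y _ => abs_le.2 ⟨?_, ?_⟩ <;> linarith [hμ.1 y, hν.1 y]
    _ = 2 := by rw [sum_add_distrib, hμ.2, hν.2]; norm_num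

theorem translate_mem_stdSimplex {μ : G → ℝ} (hμ : μ ∈ stdSimplex ℝ G) (t : G) :
    (fun y => μ (y + t)) ∈ stdSimplex ℝ G :=
  ⟨fun y => hμ.1 _, by rw [← hμ.2]; exact Equiv.sum_comp (Equiv.addRight t) μ⟩

/-- A tempered weight has small transform at every character that is far from trivial on the scale
of `ρ`. -/
theorem Tempered.charSeminorm_mul_norm_charTransform_le {ρ : AddGroupSeminorm G} {μ : G → ℝ}
    (hμ : Tempered ρ μ) (h1 : μ ∈ stdSimplex ℝ G) (χ : AddChar G ℂ) (t : G) :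
    charSeminorm χ t * ‖charTransform μ χ‖ ≤ Real.exp (ρ t) - 1 := by
  have key : (1 - χ t) * charTransform μ χ = ∑ y, ((μ (y + t) - μ y : ℝ) : ℂ) * χ (y + t) := by
    have h2 : charTransform μ χ = ∑ y, (μ (y + t) : ℂ) * χ (y + t) :=
      (Equiv.sum_comp (Equiv.addRight t) fun y => (μ y : ℂ) * χ y).symm
    rw [sub_mul, one_mul]
    nth_rewrite 1 [h2]
    rw [charTransform, mul_sum, ← sum_sub_distrib]
    refine sum_congr rfl fun y _ => ?_
    rw [AddChar.map_add_eq_mul]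
    push_cast
    ring
  rw [charSeminorm_apply, ← norm_mul, key]
  refine (norm_sum_le _ _).trans (le_trans (le_of_eq ?_) (hμ.sum_abs_sub_le h1 t))
  refine sum_congr rfl fun y _ => ?_
  rw [norm_mul, AddChar.norm_apply, mul_one, Complex.norm_real, Real.norm_eq_abs]

theorem norm_charTransform_le_one {μ : G → ℝ} (h1 : μ ∈ stdSimplex ℝ G) (χ : AddChar G ℂ) :
    ‖charTransform μ χ‖ ≤ 1 := by
  refine (norm_sum_le _ _).trans (le_of_eq ?_)
  rw [← h1.2]
  refine sum_congr rfl fun y _ => ?_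
  rw [norm_mul, AddChar.norm_apply, mul_one, Complex.norm_real, Real.norm_of_nonneg (h1.1 y)]

end Tempered

/-! ### Convolution -/

section Convolution

variable {G : Type*} [AddCommGroup G] [Fintype G]

/-- The convolution of the weight `μ` with the weight `σ`. -/
noncomputable def convWeight (σ μ : G → ℝ) (y : G) : ℝ := ∑ t, σ t * μ (y - t)

theorem convWeight_mem_stdSimplex {σ μ : G → ℝ} (hσ : σ ∈ stdSimplex ℝ G)
    (hμ : μ ∈ stdSimplex ℝ G) : convWeight σ μ ∈ stdSimplex ℝ G := by
  refine ⟨fun y => sum_nonneg fun t _ => mul_nonneg (hσ.1 t) (hμ.1 _), ?_⟩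
  simp only [convWeight]
  rw [sum_comm, ← hσ.2]
  refine sum_congr rfl fun t _ => ?_
  rw [← mul_sum]
  have h : ∑ y, μ (y - t) = 1 := by
    rw [← hμ.2]; exact Equiv.sum_comp (Equiv.subRight t) μ
  rw [h, mul_one]

theorem charTransform_convWeight (σ μ : G → ℝ) (χ : AddChar G ℂ) :
    charTransform (convWeight σ μ) χ = charTransform σ χ * charTransform μ χ := by
  simp only [charTransform, convWeight]
  push_cast
  simp only [sum_mul]
  rw [sum_comm]
  refine sum_congr rfl fun t _ => ?_
  rw [mul_sum, ← Equiv.sum_comp (Equiv.addRight t)]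
  refine sum_congr rfl fun y _ => ?_
  simp only [Equiv.coe_addRight, add_sub_cancel_right, AddChar.map_add_eq_mul]
  ring

theorem convWeight_iterate_mem_stdSimplex {σ μ : G → ℝ} (hσ : σ ∈ stdSimplex ℝ G)
    (hμ : μ ∈ stdSimplex ℝ G) (n : ℕ) : (convWeight σ)^[n] μ ∈ stdSimplex ℝ G := by
  induction n with
  | zero => exact hμ
  | succ n ih =>
    rw [Function.iterate_succ_apply']
    exact convWeight_mem_stdSimplex hσ ih

theorem charTransform_convWeight_iterate (σ μ : G → ℝ) (χ : AddChar G ℂ) (n : ℕ) :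
    charTransform ((convWeight σ)^[n] μ) χ = charTransform σ χ ^ n * charTransform μ χ := by
  induction n with
  | zero => simp
  | succ n ih =>
    rw [Function.iterate_succ_apply', charTransform_convWeight, ih, pow_succ]
    ring

theorem sum_abs_convWeight_sub_le {σ : G → ℝ} (hσ : σ ∈ stdSimplex ℝ G) (μ ν : G → ℝ) :
    ∑ y, |convWeight σ μ y - convWeight σ ν y| ≤ ∑ y, |μ y - ν y| := by
  calc ∑ y, |convWeight σ μ y - convWeight σ ν y|
      ≤ ∑ y, ∑ t, σ t * |μ (y - t) - ν (y - t)| := by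
        refine sum_le_sum fun y _ => ?_
        simp only [convWeight]
        rw [← sum_sub_distrib]
        refine (abs_sum_le_sum_abs _ _).trans (le_of_eq (sum_congr rfl fun t _ => ?_))
        rw [← mul_sub, abs_mul, abs_of_nonneg (hσ.1 t)]
    _ = ∑ y, |μ y - ν y| := by
        rw [sum_comm]
        have : ∀ t, ∑ y, σ t * |μ (y - t) - ν (y - t)| = σ t * ∑ y, |μ y - ν y| := by
          intro t
          rw [← mul_sum, ← Equiv.sum_comp (Equiv.subRight t) fun y => |μ y - ν y|]
          rfl
        simp only [this]
        rw [← sum_mul, hσ.2, one_mul]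

theorem sum_abs_convWeight_iterate_sub_le {σ μ : G → ℝ} (hσ : σ ∈ stdSimplex ℝ G) {ε : ℝ}
    (h : ∑ y, |convWeight σ μ y - μ y| ≤ ε) (n : ℕ) :
    ∑ y, |(convWeight σ)^[n] μ y - μ y| ≤ n * ε := by
  induction n with
  | zero => simp
  | succ n ih =>
    rw [Function.iterate_succ_apply']
    calc ∑ y, |convWeight σ ((convWeight σ)^[n] μ) y - μ y|
        ≤ ∑ y, (|convWeight σ ((convWeight σ)^[n] μ) y - convWeight σ μ y|
            + |convWeight σ μ y - μ y|) := sum_le_sum fun y _ => abs_sub_le _ _ _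
      _ ≤ n * ε + ε := by
          rw [sum_add_distrib]
          exact add_le_add ((sum_abs_convWeight_sub_le hσ _ _).trans ih) h
      _ = ((n + 1 : ℕ) : ℝ) * ε := by push_cast; ring

/-- Convolving a tempered weight with a Gibbs weight on a much finer scale hardly changes it. -/
theorem Tempered.sum_abs_convWeight_gibbs_sub_le {ρ : AddGroupSeminorm G} {μ : G → ℝ}
    (hμ : Tempered ρ μ) (h1 : μ ∈ stdSimplex ℝ G) {Q : ℕ} (hQ : 0 < Q) {R : ℝ} (hR : 0 ≤ R) :
    ∑ y, |convWeight (gibbs (Q • ρ)) μ y - μ y|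
      ≤ (Real.exp (R / Q) - 1) + 2 * (Fintype.card G * Real.exp (-R)) := by
  set σ := gibbs (Q • ρ) with hσdef
  have hσ : σ ∈ stdSimplex ℝ G := gibbs_mem_stdSimplex _
  have hQ' : (0 : ℝ) < Q := by exact_mod_cast hQ
  have hQρ : ∀ t, (Q • ρ) t = Q * ρ t := fun t => by
    simp
  set d : G → ℝ := fun t => ∑ y, |μ (y - t) - μ y| with hd
  have hd2 : ∀ t, d t ≤ 2 := fun t => by
    have := sum_abs_sub_le_two (translate_mem_stdSimplex h1 (-t)) h1
    simpa [hd, sub_eq_add_neg] using this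
  have hdρ : ∀ t, d t ≤ Real.exp (ρ t) - 1 := fun t => by
    have := hμ.sum_abs_sub_le h1 (-t)
    simpa [hd, sub_eq_add_neg] using this
  have hb : ∀ t, σ t * d t ≤ σ t * (Real.exp (R / Q) - 1)
      + 2 * (if R < (Q • ρ) t then σ t else 0) := by
    intro t
    have he : 0 ≤ Real.exp (R / Q) - 1 := by
      have := Real.one_le_exp (show 0 ≤ R / Q by positivity)
      linarith
    split_ifs with h
    · nlinarith [hσ.1 t, hd2 t, mul_nonneg (hσ.1 t) he]
    · rw [mul_zero, add_zero]
      refine mul_le_mul_of_nonneg_left ((hdρ t).trans ?_) (hσ.1 t)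
      rw [hQρ, not_lt] at h
      have : ρ t ≤ R / Q := by rw [le_div_iff₀ hQ']; linarith
      have := Real.exp_le_exp.2 this
      linarith
  calc ∑ y, |convWeight σ μ y - μ y| ≤ ∑ y, ∑ t, σ t * |μ (y - t) - μ y| := by
        refine sum_le_sum fun y _ => ?_
        have : convWeight σ μ y - μ y = ∑ t, σ t * (μ (y - t) - μ y) := by
          simp only [mul_sub, sum_sub_distrib, convWeight]
          rw [← sum_mul, hσ.2, one_mul]
        rw [this]
        refine (abs_sum_le_sum_abs _ _).trans (le_of_eq (sum_congr rfl fun t _ => ?_))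
        rw [abs_mul, abs_of_nonneg (hσ.1 t)]
    _ = ∑ t, σ t * d t := by
        rw [sum_comm]
        simp only [hd, mul_sum]
    _ ≤ ∑ t, (σ t * (Real.exp (R / Q) - 1) + 2 * (if R < (Q • ρ) t then σ t else 0)) :=
        sum_le_sum fun t _ => hb t
    _ ≤ _ := by
        rw [sum_add_distrib, ← sum_mul, hσ.2, one_mul, ← mul_sum, ← sum_filter]
        gcongr
        exact sum_gibbs_tail_le _ _

/-- The transform of a symmetric weight is real. -/
theorem charTransform_eq_ofReal_re {σ : G → ℝ} (h : ∀ x, σ (-x) = σ x) (χ : AddChar G ℂ) :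
    charTransform σ χ = ((charTransform σ χ).re : ℂ) := by
  symm
  rw [← Complex.conj_eq_iff_re]
  simp only [charTransform, map_sum, map_mul, Complex.conj_ofReal]
  rw [← Equiv.sum_comp (Equiv.neg G)]
  refine sum_congr rfl fun y _ => ?_
  simp [h, AddChar.map_neg_eq_conj]

end Convolution

/-! ### A derivative bound at the centre of the disc -/

section Derivative

theorem norm_sin_le_two {z : ℂ} (h : |z.im| ≤ 1) : ‖Complex.sin z‖ ≤ 2 := by
  have h1 : ‖Complex.exp (-z * Complex.I)‖ ≤ 3 := by
    rw [Complex.norm_exp]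
    refine (Real.exp_le_exp.2 (show (-z * Complex.I).re ≤ 1 by simpa using (abs_le.1 h).2)).trans ?_
    linarith [Real.exp_one_lt_d9]
  have h2 : ‖Complex.exp (z * Complex.I)‖ ≤ 3 := by
    rw [Complex.norm_exp]
    refine (Real.exp_le_exp.2 (show (z * Complex.I).re ≤ 1 by
      simpa using neg_le.1 (abs_le.1 h).1)).trans ?_
    linarith [Real.exp_one_lt_d9]
  have h3 : ‖Complex.exp (-z * Complex.I)‖ * ‖Complex.exp (z * Complex.I)‖ = 1 := by
    rw [← norm_mul, ← Complex.exp_add]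
    simp
  have h4 : ‖Complex.exp (-z * Complex.I)‖ + ‖Complex.exp (z * Complex.I)‖ ≤ 4 := by
    nlinarith [norm_nonneg (Complex.exp (-z * Complex.I)), norm_nonneg (Complex.exp (z * Complex.I))]
  rw [Complex.sin, norm_div, norm_mul, Complex.norm_I, mul_one]
  have h5 := norm_sub_le (Complex.exp (-z * Complex.I)) (Complex.exp (z * Complex.I))
  have h6 : ‖(2 : ℂ)‖ = 2 := by norm_num
  rw [h6]
  linarith

/-- An entire function that is bounded by `B` on the real interval `[-1, 1]` and by `B * 2 ^ N` on
the unit disc has derivative `O(N * B)` at the origin. Composing with the sine turns the interval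
into the real line and the disc into a strip, where the three lines theorem applies. -/
theorem norm_deriv_zero_le_of_bound {h : ℂ → ℂ} (hd : Differentiable ℂ h) {B : ℝ} (hB : 0 < B)
    {N : ℕ} (hN : 0 < N) (h1 : ∀ a : ℝ, |a| ≤ 1 → ‖h a‖ ≤ B)
    (h2 : ∀ z : ℂ, ‖z‖ ≤ 1 → ‖h z‖ ≤ B * 2 ^ N) : ‖deriv h 0‖ ≤ 4 * N * B := by
  have hN' : (0 : ℝ) < N := by exact_mod_cast hN
  set g : ℂ → ℂ := fun w => h (Complex.sin w / 2) with hg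
  have hgd : Differentiable ℂ g := hd.comp (Complex.differentiable_sin.div_const 2)
  have hstrip : ∀ w : ℂ, |w.im| ≤ 1 → ‖g w‖ ≤ B * 2 ^ N := fun w hw => by
    refine h2 _ ?_
    rw [norm_div, Complex.norm_ofNat]
    linarith [norm_sin_le_two hw]
  have hreal : ∀ w : ℂ, w.im = 0 → ‖g w‖ ≤ B := fun w hw => by
    obtain ⟨x, rfl⟩ : ∃ x : ℝ, w = x := ⟨w.re, Complex.ext (by simp) (by simp [hw])⟩
    have : g x = h ((Real.sin x / 2 : ℝ) : ℂ) := by simp [hg]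
    rw [this]
    refine h1 _ ?_
    rw [abs_div, abs_two]
    linarith [Real.abs_sin_le_one x]
  -- the three lines theorem in the upper (`u = I`) and in the lower (`u = -I`) strip
  have hthree : ∀ u : ℂ, u.re = 0 → |u.im| = 1 → ∀ w : ℂ, 0 ≤ w.re → w.re ≤ 1 →
      ‖g (u * w)‖ ≤ B ^ (1 - w.re) * (B * 2 ^ N) ^ w.re := by
    intro u hu0 hu1 w hw0 hw1
    have him : ∀ z : ℂ, |(u * z).im| = |z.re| := fun z => by
      rw [Complex.mul_im, hu0, zero_mul, zero_add, abs_mul, hu1, one_mul]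
    refine Complex.HadamardThreeLines.norm_le_interp_of_mem_verticalClosedStrip₀₁'
      (fun z => g (u * z)) ⟨hw0, hw1⟩
      (hgd.comp (differentiable_id.const_mul u)).diffContOnCl ?_ ?_ ?_
    · refine ⟨B * 2 ^ N, ?_⟩
      rintro _ ⟨z, hz, rfl⟩
      refine hstrip _ ?_
      rw [him, abs_of_nonneg hz.1]
      exact hz.2
    · intro z hz
      refine hreal _ (abs_eq_zero.1 ?_)
      rw [him, show z.re = 0 from hz, abs_zero]
    · intro z hz
      refine hstrip _ ?_
      rw [him, show z.re = 1 from hz, abs_one]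
  have hsmall : ∀ u : ℂ, u.re = 0 → |u.im| = 1 → ∀ w : ℂ, 0 ≤ w.re → w.re ≤ 1 / N →
      ‖g (u * w)‖ ≤ 2 * B := by
    intro u hu0 hu1 w hw0 hw1
    have hw2 : w.re ≤ 1 := hw1.trans (by
      rw [div_le_one hN']
      exact_mod_cast hN)
    refine (hthree u hu0 hu1 w hw0 hw2).trans ?_
    rw [Real.mul_rpow hB.le (by positivity), ← mul_assoc, ← Real.rpow_add hB, sub_add_cancel,
      Real.rpow_one, ← Real.rpow_natCast, ← Real.rpow_mul (by norm_num)]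
    have h3 : (N : ℝ) * w.re ≤ 1 := by
      rw [le_div_iff₀ hN'] at hw1
      linarith
    have h4 : (2 : ℝ) ^ ((N : ℝ) * w.re) ≤ 2 ^ (1 : ℝ) :=
      Real.rpow_le_rpow_of_exponent_le (by norm_num) h3
    rw [Real.rpow_one] at h4
    nlinarith
  have hcauchy : ‖deriv g 0‖ ≤ 2 * B / (1 / N) := by
    refine Complex.norm_deriv_le_of_forall_mem_sphere_norm_le (by positivity) hgd.diffContOnCl ?_
    intro z hz
    have hz1 : ‖z‖ = 1 / N := by simpa using hz
    have hz2 := Complex.abs_im_le_norm z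
    rw [hz1] at hz2
    by_cases h0 : 0 ≤ z.im
    · have := hsmall Complex.I (by simp) (by simp) (-Complex.I * z) (by simpa using h0)
        (by simpa using (abs_le.1 hz2).2)
      simpa [← mul_assoc] using this
    · have := hsmall (-Complex.I) (by simp) (by simp) (Complex.I * z)
        (by simpa using (not_le.1 h0).le) (by simpa using neg_le.1 (abs_le.1 hz2).1)
      simpa [← mul_assoc] using this
  have hderiv : deriv g 0 = deriv h 0 * (1 / 2) := by
    have ha : HasDerivAt (fun w : ℂ => Complex.sin w / 2) (1 / 2) 0 := by
      have := (Complex.hasDerivAt_sin 0).div_const 2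
      simpa using this
    have hb : HasDerivAt h (deriv h 0) (Complex.sin 0 / 2) := by
      have := (hd 0).hasDerivAt
      simpa using this
    exact (hb.comp (0 : ℂ) ha).deriv
  rw [hderiv, norm_mul] at hcauchy
  have h5 : ‖(1 / 2 : ℂ)‖ = 1 / 2 := by norm_num
  rw [h5, div_div_eq_mul_div, div_one] at hcauchy
  linarith

end Derivative

/-! ### Riesz products over dissociated sets of characters -/

section Riesz

variable {G : Type*} [AddCommGroup G] [Fintype G]

/-- The product of the characters in `U` and of the inverses of the characters in `T \ U`. -/
noncomputable def signedProd (T U : Finset (AddChar G ℂ)) : AddChar G ℂ :=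
  (∏ χ ∈ U, χ) * (∏ χ ∈ T \ U, χ)⁻¹

/-- A finite set `Λ` of characters is dissociated modulo `N` if no nonempty product of distinct
elements of `Λ`, each taken with exponent `1` or `-1`, lies in `N`. -/
def Dissociated (N : Set (AddChar G ℂ)) (Λ : Finset (AddChar G ℂ)) : Prop :=
  ∀ T ⊆ Λ, T.Nonempty → ∀ U ⊆ T, signedProd T U ∉ N

theorem prod_re_mul_eq (c : AddChar G ℂ → ℂ) (T : Finset (AddChar G ℂ)) (y : G) :
    ((∏ χ ∈ T, (c χ * χ y).re : ℝ) : ℂ) = ∑ U ∈ T.powerset, (1 / 2 : ℂ) ^ #T *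
      ((∏ χ ∈ U, c χ) * ∏ χ ∈ T \ U, (starRingEnd ℂ) (c χ)) * signedProd T U y := by
  have h1 : ∀ χ : AddChar G ℂ, (((c χ * χ y).re : ℝ) : ℂ)
      = 1 / 2 * (c χ * χ y + (starRingEnd ℂ) (c χ) * χ⁻¹ y) := by
    intro χ
    rw [Complex.re_eq_add_conj, map_mul, AddChar.inv_apply, AddChar.map_neg_eq_conj]
    ring
  rw [Complex.ofReal_prod, prod_congr rfl fun χ _ => h1 χ, prod_mul_distrib, prod_const, prod_add,
    mul_sum]
  refine sum_congr rfl fun U _ => ?_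
  rw [signedProd, ← prod_inv_distrib, AddChar.mul_apply, AddChar.prod_apply, AddChar.prod_apply,
    prod_mul_distrib, prod_mul_distrib]
  ring

theorem sum_mul_prod_re_eq (μ : G → ℝ) (γ : AddChar G ℂ) (c : AddChar G ℂ → ℂ)
    (T : Finset (AddChar G ℂ)) :
    ∑ y, (μ y : ℂ) * γ y * ((∏ χ ∈ T, (c χ * χ y).re : ℝ) : ℂ) =
      ∑ U ∈ T.powerset, (1 / 2 : ℂ) ^ #T *
        ((∏ χ ∈ U, c χ) * ∏ χ ∈ T \ U, (starRingEnd ℂ) (c χ)) *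
          charTransform μ (γ * signedProd T U) := by
  simp only [prod_re_mul_eq, charTransform, mul_sum]
  rw [sum_comm]
  refine sum_congr rfl fun U _ => sum_congr rfl fun y _ => ?_
  rw [AddChar.mul_apply]
  ring

/-- The average of the absolute values of the transform of `ν` at the translates by `γ` of the
signed products over `T`. -/
noncomputable def rieszCoeff (ν : G → ℝ) (γ : AddChar G ℂ) (T : Finset (AddChar G ℂ)) : ℝ :=
  ∑ U ∈ T.powerset, (1 / 2 : ℝ) ^ #T * ‖charTransform ν (γ * signedProd T U)‖

theorem norm_sum_mul_prod_re_le {μ ν : G → ℝ} (hμν : ∀ χ, ‖charTransform μ χ‖ ≤ ‖charTransform ν χ‖)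
    (γ : AddChar G ℂ) {c : AddChar G ℂ → ℂ} (hc : ∀ χ, ‖c χ‖ = 1) (T : Finset (AddChar G ℂ)) :
    ‖∑ y, (μ y : ℂ) * γ y * ((∏ χ ∈ T, (c χ * χ y).re : ℝ) : ℂ)‖ ≤ rieszCoeff ν γ T := by
  rw [sum_mul_prod_re_eq]
  refine (norm_sum_le _ _).trans (sum_le_sum fun U _ => ?_)
  have h : ‖(1 / 2 : ℂ)‖ = 1 / 2 := by norm_num
  rw [norm_mul, norm_mul, norm_mul, norm_pow, h, norm_prod, norm_prod]
  simp only [hc, RCLike.norm_conj, prod_const_one, mul_one]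
  gcongr
  exact hμν _

/-- For a weight with nonnegative transform the coefficients of the Riesz product are largest at the
trivial character. -/
theorem sum_rieszCoeff_le {ν : G → ℝ} (hν : ν ∈ stdSimplex ℝ G)
    (hpos : ∀ χ, charTransform ν χ = (‖charTransform ν χ‖ : ℂ)) (γ : AddChar G ℂ)
    (Λ : Finset (AddChar G ℂ)) :
    ∑ T ∈ Λ.powerset, rieszCoeff ν γ T ≤ ∑ T ∈ Λ.powerset, rieszCoeff ν 1 T := by
  have key : ∀ γ : AddChar G ℂ, ((∑ T ∈ Λ.powerset, rieszCoeff ν γ T : ℝ) : ℂ)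
      = ∑ y, (ν y : ℂ) * γ y * ((∏ χ ∈ Λ, (1 + (χ y).re) : ℝ) : ℂ) := by
    intro γ
    simp only [prod_one_add, Complex.ofReal_sum, mul_sum]
    rw [sum_comm]
    refine sum_congr rfl fun T _ => ?_
    have h := sum_mul_prod_re_eq ν γ (fun _ => 1) T
    simp only [one_mul] at h
    rw [h]
    simp only [rieszCoeff, Complex.ofReal_sum, map_one, prod_const_one, mul_one]
    refine sum_congr rfl fun U _ => ?_
    rw [hpos (γ * signedProd T U)]
    push_cast
    simp
  have hnn : ∀ y, 0 ≤ ∏ χ ∈ Λ, (1 + (χ y).re) := fun y => prod_nonneg fun χ _ => by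
    have := (abs_le.1 (Complex.abs_re_le_norm (χ y))).1
    rw [χ.norm_apply] at this
    linarith
  have hR : ∀ γ : AddChar G ℂ, 0 ≤ ∑ T ∈ Λ.powerset, rieszCoeff ν γ T := fun γ =>
    sum_nonneg fun T _ => sum_nonneg fun U _ => by positivity
  have h1 : ‖((∑ T ∈ Λ.powerset, rieszCoeff ν γ T : ℝ) : ℂ)‖
      ≤ ∑ y, ν y * ∏ χ ∈ Λ, (1 + (χ y).re) := by
    rw [key γ]
    refine (norm_sum_le _ _).trans (le_of_eq (sum_congr rfl fun y _ => ?_))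
    rw [norm_mul, norm_mul, γ.norm_apply, mul_one, Complex.norm_real, Complex.norm_real,
      Real.norm_of_nonneg (hν.1 y), Real.norm_of_nonneg (hnn y)]
  have h2 : (∑ T ∈ Λ.powerset, rieszCoeff ν 1 T) = ∑ y, ν y * ∏ χ ∈ Λ, (1 + (χ y).re) := by
    have := key 1
    simp only [AddChar.one_apply, mul_one] at this
    exact_mod_cast this
  rw [Complex.norm_real, Real.norm_of_nonneg (hR γ)] at h1
  rwa [h2]

theorem sum_rieszCoeff_one_le_two {ν : G → ℝ} (hν : ν ∈ stdSimplex ℝ G) {N : Set (AddChar G ℂ)}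
    {Λ : Finset (AddChar G ℂ)} (hΛ : Dissociated N Λ)
    (hsmall : ∀ χ ∉ N, ‖charTransform ν χ‖ ≤ (1 / 2) ^ #Λ) :
    ∑ T ∈ Λ.powerset, rieszCoeff ν 1 T ≤ 2 := by
  have h0 : rieszCoeff ν 1 (∅ : Finset (AddChar G ℂ)) ≤ 1 := by
    simpa [rieszCoeff] using norm_charTransform_le_one hν _
  have h1 : ∀ T ∈ Λ.powerset.erase ∅, rieszCoeff ν 1 T ≤ (1 / 2) ^ #Λ := by
    intro T hT
    rw [mem_erase, mem_powerset] at hT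
    calc rieszCoeff ν 1 T ≤ ∑ U ∈ T.powerset, (1 / 2 : ℝ) ^ #T * (1 / 2) ^ #Λ := by
          refine sum_le_sum fun U hU => ?_
          rw [one_mul]
          gcongr
          exact hsmall _ (hΛ T hT.2 (nonempty_iff_ne_empty.2 hT.1) U (mem_powerset.1 hU))
      _ = (1 / 2) ^ #Λ := by
          rw [sum_const, card_powerset, nsmul_eq_mul]
          push_cast
          rw [← mul_assoc, ← mul_pow]
          norm_num
  rw [← add_sum_erase _ _ (empty_mem_powerset Λ)]
  have h2 : ∑ T ∈ Λ.powerset.erase ∅, rieszCoeff ν 1 T ≤ 1 := by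
    calc ∑ T ∈ Λ.powerset.erase ∅, rieszCoeff ν 1 T ≤ ∑ T ∈ Λ.powerset.erase ∅, (1 / 2 : ℝ) ^ #Λ :=
          sum_le_sum h1
      _ ≤ ∑ T ∈ Λ.powerset, (1 / 2 : ℝ) ^ #Λ :=
          sum_le_sum_of_subset_of_nonneg (erase_subset _ _) fun _ _ _ => by positivity
      _ = 1 := by
          rw [sum_const, card_powerset, nsmul_eq_mul]
          push_cast
          rw [← mul_pow]
          norm_num
  linarith

/-- Bessel-type inequality for the `A(G)`-norm: the Fourier coefficients of a bounded function with
`A(G)`-norm at most `2 ^ n`, taken over a dissociated set, have sum `O(n)`. The hypotheses let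
`N` be the set of characters at which the smoothing weight `ν` fails to have tiny transform. -/
theorem sum_norm_le_of_dissociated {μ ν : G → ℝ} (hμ : μ ∈ stdSimplex ℝ G)
    (hν : ν ∈ stdSimplex ℝ G) (hpos : ∀ χ, charTransform ν χ = (‖charTransform ν χ‖ : ℂ))
    (hμν : ∀ χ, ‖charTransform μ χ‖ ≤ ‖charTransform ν χ‖)
    {N : Set (AddChar G ℂ)} {Λ : Finset (AddChar G ℂ)} (hΛ : Dissociated N Λ)
    (hsmall : ∀ χ ∉ N, ‖charTransform ν χ‖ ≤ (1 / 2) ^ #Λ)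
    {f : G → ℝ} (hf : ∀ x, |f x| ≤ 1) {n : ℕ} (hn : 0 < n)
    (hM : wienerNorm (fun x => (f x : ℂ)) ≤ 2 ^ n) :
    ∑ χ ∈ Λ, ‖∑ y, (μ y : ℂ) * f y * χ y‖ ≤ 8 * n := by
  -- unimodular `c χ` turning `∑ μ f χ` into its absolute value
  have hphase : ∀ z : ℂ, ∃ u : ℂ, ‖u‖ = 1 ∧ u * z = ‖z‖ := by
    intro z
    by_cases hz : z = 0
    · exact ⟨1, by simp, by simp [hz]⟩
    · have hz' : (‖z‖ : ℂ) ≠ 0 := by simpa using hz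
      refine ⟨(starRingEnd ℂ) z / ‖z‖, ?_, ?_⟩
      · simp [hz]
      · rw [div_mul_eq_mul_div, Complex.conj_mul', pow_two, mul_div_assoc, div_self hz', mul_one]
  choose u hu1 hu2 using hphase
  set c : AddChar G ℂ → ℂ := fun χ => u (∑ y, (μ y : ℂ) * f y * χ y) with hc
  have hc1 : ∀ χ, ‖c χ‖ = 1 := fun χ => hu1 _
  set r : AddChar G ℂ → G → ℝ := fun χ y => (c χ * χ y).re with hr
  have hr1 : ∀ χ y, |r χ y| ≤ 1 := fun χ y => by
    refine (Complex.abs_re_le_norm _).trans (le_of_eq ?_)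
    rw [norm_mul, hc1, χ.norm_apply, one_mul]
  set h : ℂ → ℂ := fun z => ∑ y, (μ y : ℂ) * f y * ∏ χ ∈ Λ, (1 + z * r χ y) with hh
  have hderiv : ∀ z : ℂ, HasDerivAt h (∑ y, (μ y : ℂ) * f y *
      ∑ χ ∈ Λ, (∏ ψ ∈ Λ.erase χ, (1 + z * r ψ y)) * r χ y) z := by
    intro z
    refine HasDerivAt.fun_sum fun y _ => HasDerivAt.const_mul _ ?_
    have := HasDerivAt.fun_finsetProd (u := Λ) (f := fun (χ : AddChar G ℂ) (z : ℂ) => 1 + z * r χ y)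
      (f' := fun χ => (r χ y : ℂ)) (x := z) fun χ _ => by
        simpa using ((hasDerivAt_id z).mul_const (r χ y : ℂ)).const_add 1
    simpa using this
  have hexp : ∀ (z : ℂ) (y : G), ∏ χ ∈ Λ, (1 + z * r χ y)
      = ∑ T ∈ Λ.powerset, z ^ #T * ((∏ χ ∈ T, r χ y : ℝ) : ℂ) := by
    intro z y
    rw [prod_one_add]
    refine sum_congr rfl fun T _ => ?_
    rw [prod_mul_distrib, prod_const, Complex.ofReal_prod]
  have hgam : ∀ (γ : AddChar G ℂ) (z : ℂ), ‖z‖ ≤ 1 →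
      ‖∑ y, (μ y : ℂ) * γ y * ∏ χ ∈ Λ, (1 + z * r χ y)‖ ≤ 2 := by
    intro γ z hz
    have h1 : ∑ y, (μ y : ℂ) * γ y * ∏ χ ∈ Λ, (1 + z * r χ y) = ∑ T ∈ Λ.powerset, z ^ #T *
        ∑ y, (μ y : ℂ) * γ y * ((∏ χ ∈ T, r χ y : ℝ) : ℂ) := by
      simp only [hexp, mul_sum]
      rw [sum_comm]
      refine sum_congr rfl fun T _ => sum_congr rfl fun y _ => ?_
      ring
    rw [h1]
    refine (norm_sum_le _ _).trans (le_trans (sum_le_sum fun T _ => ?_)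
      ((sum_rieszCoeff_le hν hpos γ Λ).trans (sum_rieszCoeff_one_le_two hν hΛ hsmall)))
    rw [norm_mul, norm_pow]
    refine (mul_le_of_le_one_left (norm_nonneg _) (pow_le_one₀ (norm_nonneg _) hz)).trans ?_
    exact norm_sum_mul_prod_re_le hμν γ hc1 T
  have hdisc : ∀ z : ℂ, ‖z‖ ≤ 1 → ‖h z‖ ≤ 2 * 2 ^ n := by
    intro z hz
    have h1 : h z = ∑ γ : AddChar G ℂ, fourierCoeffFin (fun x => (f x : ℂ)) γ *
        ∑ y, (μ y : ℂ) * γ y * ∏ χ ∈ Λ, (1 + z * r χ y) := by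
      simp only [hh, mul_sum]
      rw [sum_comm]
      refine sum_congr rfl fun y _ => ?_
      rw [← sum_fourierCoeffFin_mul (fun x => (f x : ℂ)) y, mul_sum, sum_mul]
      refine sum_congr rfl fun γ _ => ?_
      ring
    rw [h1]
    calc ‖∑ γ : AddChar G ℂ, fourierCoeffFin (fun x => (f x : ℂ)) γ *
        ∑ y, (μ y : ℂ) * γ y * ∏ χ ∈ Λ, (1 + z * r χ y)‖
        ≤ ∑ γ : AddChar G ℂ, ‖fourierCoeffFin (fun x => (f x : ℂ)) γ‖ * 2 := by
          refine (norm_sum_le _ _).trans (sum_le_sum fun γ _ => ?_)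
          rw [norm_mul]
          gcongr
          exact hgam γ z hz
      _ ≤ 2 * 2 ^ n := by
          rw [← sum_mul, mul_comm]
          gcongr
          exact hM
  have hint : ∀ a : ℝ, |a| ≤ 1 → ‖h a‖ ≤ 2 := by
    intro a ha
    have hnn : ∀ y, 0 ≤ ∏ χ ∈ Λ, (1 + a * r χ y) := fun y => prod_nonneg fun χ _ => by
      have h1 : |a * r χ y| ≤ 1 := by
        rw [abs_mul]
        exact mul_le_one₀ ha (abs_nonneg _) (hr1 χ y)
      linarith [(abs_le.1 h1).1]
    have hcast : ∀ y, ∏ χ ∈ Λ, (1 + (a : ℂ) * r χ y) = ((∏ χ ∈ Λ, (1 + a * r χ y) : ℝ) : ℂ) :=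
      fun y => by push_cast; rfl
    have h1 : ‖h a‖ ≤ ∑ y, μ y * ∏ χ ∈ Λ, (1 + a * r χ y) := by
      refine (norm_sum_le _ _).trans (sum_le_sum fun y _ => ?_)
      rw [hcast, norm_mul, norm_mul, Complex.norm_real, Complex.norm_real, Complex.norm_real,
        Real.norm_of_nonneg (hμ.1 y), Real.norm_of_nonneg (hnn y), Real.norm_eq_abs]
      refine mul_le_mul_of_nonneg_right ?_ (hnn y)
      exact mul_le_of_le_one_right (hμ.1 y) (hf y)
    have h2 : (∑ y, μ y * ∏ χ ∈ Λ, (1 + a * r χ y)) ≤ 2 := by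
      have h3 := hgam 1 a (by simpa using ha)
      simp only [hcast, AddChar.one_apply, mul_one] at h3
      have h4 : ∑ y, (μ y : ℂ) * ((∏ χ ∈ Λ, (1 + a * r χ y) : ℝ) : ℂ)
          = ((∑ y, μ y * ∏ χ ∈ Λ, (1 + a * r χ y) : ℝ) : ℂ) := by push_cast; rfl
      rw [h4, Complex.norm_real] at h3
      exact (le_abs_self _).trans h3
    exact h1.trans h2
  have hfin := norm_deriv_zero_le_of_bound (fun z => (hderiv z).differentiableAt) two_pos hn hint
    hdisc
  have hval : deriv h 0 = ((∑ χ ∈ Λ, ‖∑ y, (μ y : ℂ) * f y * χ y‖ : ℝ) : ℂ) := by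
    rw [(hderiv 0).deriv]
    simp only [zero_mul, add_zero, prod_const_one, one_mul, mul_sum]
    rw [sum_comm, Complex.ofReal_sum]
    refine sum_congr rfl fun χ _ => ?_
    have h1 : ((∑ y, μ y * f y * r χ y : ℝ) : ℂ) = ∑ y, (μ y : ℂ) * f y * (r χ y : ℂ) := by
      push_cast; rfl
    have h2 : (∑ y, μ y * f y * r χ y) = (c χ * ∑ y, (μ y : ℂ) * f y * χ y).re := by
      rw [mul_sum, Complex.re_sum]
      refine sum_congr rfl fun y _ => ?_
      have h3 : c χ * ((μ y : ℂ) * f y * χ y) = ((μ y * f y : ℝ) : ℂ) * (c χ * χ y) := by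
        push_cast; ring
      rw [h3, Complex.re_ofReal_mul]
    rw [← h1, h2, hc]
    simp only [hu2, Complex.ofReal_re]
  rw [hval, Complex.norm_real, Real.norm_eq_abs] at hfin
  refine (le_abs_self _).trans (hfin.trans (le_of_eq ?_))
  ring

end Riesz

/-! ### The large spectrum of a function with small `A(G)`-norm -/

section Spectrum

variable {G : Type*} [AddCommGroup G] [Fintype G]

omit [Fintype G] in
theorem Dissociated.insert_witness [DecidableEq (AddChar G ℂ)] {N : Set (AddChar G ℂ)}
    {Λ : Finset (AddChar G ℂ)} (hΛ : Dissociated N Λ) {γ : AddChar G ℂ}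
    (h : ¬ Dissociated N (insert γ Λ)) :
    ∃ T ⊆ insert γ Λ, γ ∈ T ∧ ∃ U ⊆ T, signedProd T U ∈ N := by
  simp only [Dissociated, not_forall, not_not] at h
  obtain ⟨T, hT, hne, U, hU, hN⟩ := h
  refine ⟨T, hT, ?_, U, hU, hN⟩
  by_contra hγ
  exact hΛ T ((subset_insert_iff_of_notMem hγ).1 hT) hne U hU hN

theorem charSeminorm_le_of_mem {γ : AddChar G ℂ} {s : Finset (AddChar G ℂ)} (hγ : γ ∈ s) (t : G) :
    charSeminorm γ t ≤ charSeminorm (∏ χ ∈ s, χ) t + ∑ χ ∈ s.erase γ, charSeminorm χ t := by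
  have h : γ = (∏ χ ∈ s, χ) * (∏ χ ∈ s.erase γ, χ)⁻¹ := by
    rw [← mul_prod_erase s _ hγ, mul_inv_cancel_right]
  nth_rewrite 1 [h]
  refine (charSeminorm_mul_le _ _ t).trans ?_
  rw [charSeminorm_inv]
  gcongr
  exact charSeminorm_prod_le _ t

/-- A member `γ` of `T` is as close to trivial as the signed product over `T` and the other members
of `T` allow. -/
theorem charSeminorm_le_signedProd {γ : AddChar G ℂ} {T U : Finset (AddChar G ℂ)} (hγ : γ ∈ T)
    (hU : U ⊆ T) (t : G) :
    charSeminorm γ t ≤ charSeminorm (signedProd T U) t + ∑ χ ∈ T.erase γ, charSeminorm χ t := by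
  have hmono : ∀ s ⊆ T.erase γ, ∀ s' ⊆ T.erase γ, Disjoint s s' →
      ∑ χ ∈ s, charSeminorm χ t + ∑ χ ∈ s', charSeminorm χ t
        ≤ ∑ χ ∈ T.erase γ, charSeminorm χ t := by
    intro s hs s' hs' hd
    rw [← sum_union hd]
    exact sum_le_sum_of_subset_of_nonneg (union_subset hs hs') fun _ _ _ => charSeminorm_nonneg _ _
  have hUe : U.erase γ ⊆ T.erase γ := erase_subset_erase _ hU
  have hTe : (T \ U).erase γ ⊆ T.erase γ := erase_subset_erase _ sdiff_subset
  have hdis : Disjoint (U.erase γ) ((T \ U).erase γ) :=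
    disjoint_sdiff.mono (erase_subset _ _) (erase_subset _ _)
  by_cases h : γ ∈ U
  · have hne : γ ∉ T \ U := fun hm => (mem_sdiff.1 hm).2 h
    have h1 : ∏ χ ∈ U, χ = signedProd T U * ∏ χ ∈ T \ U, χ := by
      rw [signedProd, inv_mul_cancel_right]
    have h2 := charSeminorm_le_of_mem h t
    have h3 := charSeminorm_mul_le (signedProd T U) (∏ χ ∈ T \ U, χ) t
    have h4 := charSeminorm_prod_le (T \ U) t
    have h5 := hmono _ hUe _ hTe hdis
    rw [erase_eq_of_notMem hne] at h5
    rw [h1] at h2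
    linarith
  · have hm : γ ∈ T \ U := mem_sdiff.2 ⟨hγ, h⟩
    have h1 : ∏ χ ∈ T \ U, χ = (signedProd T U)⁻¹ * ∏ χ ∈ U, χ := by
      rw [signedProd, mul_inv, inv_inv]
      rw [mul_comm (∏ χ ∈ U, χ)⁻¹, inv_mul_cancel_right]
    have h2 := charSeminorm_le_of_mem hm t
    have h3 := charSeminorm_mul_le (signedProd T U)⁻¹ (∏ χ ∈ U, χ) t
    have h4 := charSeminorm_prod_le U t
    have h5 := hmono _ hUe _ hTe hdis
    rw [erase_eq_of_notMem h] at h5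
    rw [h1] at h2
    rw [charSeminorm_inv] at h3
    linarith

/-- Structure of the large spectrum, relative to a tempered weight `μ`, of a bounded function with
`A(G)`-norm at most `2 ^ n`: at the level `s` it is controlled by `O(n / s)` characters together
with a multiple of `ρ`. The quantity `D` bounds the size of the dissociated sets that have to be
examined, and `Q` is the ratio between the scale of `μ` and the finer scale used for smoothing. -/
theorem exists_card_le_and_charSeminorm_le {ρ : AddGroupSeminorm G} {μ : G → ℝ}
    (hμ : Tempered ρ μ) (h1 : μ ∈ stdSimplex ℝ G) {f : G → ℝ} (hf : ∀ x, |f x| ≤ 1) {n : ℕ}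
    (hn : 0 < n) (hM : wienerNorm (fun x => (f x : ℂ)) ≤ 2 ^ n) {s : ℝ} (hs : 0 < s)
    {D Q : ℕ} (hQ : 0 < Q) (hD : 16 * n / s < D) {R : ℝ} (hR : 0 ≤ R)
    (hsm : (2 * D : ℕ) * ((Real.exp (R / Q) - 1) + 2 * (Fintype.card G * Real.exp (-R))) ≤ s / 2)
    (S : Finset (AddChar G ℂ)) (hS : ∀ γ ∈ S, s ≤ ‖∑ y, (μ y : ℂ) * f y * γ y‖) :
    ∃ Λ ⊆ S, (#Λ : ℝ) ≤ 16 * n / s ∧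
      ∀ γ ∈ S, ∀ t, charSeminorm γ t ≤ ∑ χ ∈ Λ, charSeminorm χ t + 4 * Q * ρ t := by
  classical
  set σ := gibbs (Q • ρ) with hσdef
  have hσ : σ ∈ stdSimplex ℝ G := gibbs_mem_stdSimplex _
  have hQ' : (0 : ℝ) < Q := by exact_mod_cast hQ
  set N : Set (AddChar G ℂ) := {χ | ∀ t, charSeminorm χ t ≤ 4 * Q * ρ t} with hN
  have hσN : ∀ χ ∉ N, ‖charTransform σ χ‖ ≤ 1 / 2 := by
    intro χ hχ
    simp only [hN, Set.mem_ofPred_eq, not_forall, not_le] at hχ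
    obtain ⟨t, ht⟩ := hχ
    have h2 := (gibbs_tempered (Q • ρ)).charSeminorm_mul_norm_charTransform_le hσ χ t
    have h3 : (Q • ρ) t = Q * ρ t := by simp
    have h4 : 0 ≤ Q * ρ t := mul_nonneg hQ'.le (apply_nonneg ρ t)
    have h5 := charSeminorm_le_two χ t
    rw [h3] at h2
    have h6 : Real.exp (Q * ρ t) - 1 ≤ 2 * (Q * ρ t) := by
      have h7 : |Q * ρ t| ≤ 1 := by rw [abs_of_nonneg h4]; linarith
      have h8 := Real.abs_exp_sub_one_le h7
      rw [abs_of_nonneg h4] at h8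
      exact (le_abs_self _).trans h8
    have h9 : 0 < charSeminorm χ t := by linarith
    by_contra hcon
    push Not at hcon
    nlinarith
  -- the point mass at the origin and `μ`, both smoothed by `2 * D` convolutions with `σ`
  set δ₀ : G → ℝ := Pi.single 0 1 with hδ₀
  have hδ : δ₀ ∈ stdSimplex ℝ G := single_mem_stdSimplex ℝ 0
  set ν : G → ℝ := (convWeight σ)^[2 * D] δ₀ with hν
  set μ' : G → ℝ := (convWeight σ)^[2 * D] μ with hμ'
  have hνT : ∀ χ, charTransform ν χ = charTransform σ χ ^ (2 * D) := by
    intro χ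
    rw [hν, charTransform_convWeight_iterate]
    have : charTransform δ₀ χ = 1 := by
      simp only [charTransform, hδ₀]
      rw [sum_eq_single 0 (fun y _ hy => by simp [hy]) (by simp)]
      simp
    rw [this, mul_one]
  have hνpos : ∀ χ, charTransform ν χ = (‖charTransform ν χ‖ : ℂ) := by
    intro χ
    rw [hνT, pow_mul, charTransform_eq_ofReal_re (fun x => gibbs_neg (Q • ρ) x) χ]
    rw [← Complex.ofReal_pow, ← Complex.ofReal_pow, Complex.norm_real, Real.norm_of_nonneg]
    positivity
  have hμν : ∀ χ, ‖charTransform μ' χ‖ ≤ ‖charTransform ν χ‖ := by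
    intro χ
    rw [hμ', charTransform_convWeight_iterate, hνT, norm_mul]
    exact mul_le_of_le_one_right (norm_nonneg _) (norm_charTransform_le_one h1 χ)
  have hclose : ∀ γ ∈ S, s / 2 ≤ ‖∑ y, (μ' y : ℂ) * f y * γ y‖ := by
    intro γ hγ
    have h2 := (sum_abs_convWeight_iterate_sub_le hσ
      (hμ.sum_abs_convWeight_gibbs_sub_le h1 hQ hR) (2 * D)).trans hsm
    have h3 : ‖∑ y, (μ' y : ℂ) * f y * γ y - ∑ y, (μ y : ℂ) * f y * γ y‖
        ≤ ∑ y, |μ' y - μ y| := by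
      rw [← sum_sub_distrib]
      refine (norm_sum_le _ _).trans (sum_le_sum fun y _ => ?_)
      have h4 : (μ' y : ℂ) * f y * γ y - (μ y : ℂ) * f y * γ y
          = ((μ' y - μ y : ℝ) : ℂ) * (f y * γ y) := by push_cast; ring
      rw [h4, norm_mul, norm_mul, γ.norm_apply, mul_one, Complex.norm_real, Complex.norm_real,
        Real.norm_eq_abs, Real.norm_eq_abs]
      exact mul_le_of_le_one_right (abs_nonneg _) (hf y)
    have h5 := hS γ hγ
    have h6 := norm_sub_norm_le (∑ y, (μ y : ℂ) * f y * γ y) (∑ y, (μ' y : ℂ) * f y * γ y)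
    rw [norm_sub_rev] at h6
    linarith
  have hbound : ∀ Λ ⊆ S, #Λ ≤ D → Dissociated N Λ → (#Λ : ℝ) ≤ 16 * n / s := by
    intro Λ hΛS hΛD hΛ
    have h2 := sum_norm_le_of_dissociated (convWeight_iterate_mem_stdSimplex hσ h1 (2 * D))
      (convWeight_iterate_mem_stdSimplex hσ hδ (2 * D)) hνpos hμν hΛ (fun χ hχ => by
        rw [hνT, norm_pow]
        calc ‖charTransform σ χ‖ ^ (2 * D) ≤ (1 / 2) ^ (2 * D) :=
              pow_le_pow_left₀ (norm_nonneg _) (hσN χ hχ) _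
          _ ≤ (1 / 2) ^ #Λ := pow_le_pow_of_le_one (by norm_num) (by norm_num) (by omega)) hf hn hM
    have h3 : #Λ * (s / 2) ≤ ∑ χ ∈ Λ, ‖∑ y, (μ' y : ℂ) * f y * χ y‖ := by
      rw [← nsmul_eq_mul]
      exact card_nsmul_le_sum _ _ _ fun χ hχ => hclose χ (hΛS hχ)
    rw [le_div_iff₀ hs]
    linarith
  -- a largest dissociated subset of `S` among those of size at most `D`
  obtain ⟨Λ, hΛ, hmax⟩ := exists_max_image
    (S.powerset.filter fun Λ => #Λ ≤ D ∧ Dissociated N Λ) card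
    ⟨∅, by simp [Dissociated, subset_empty, nonempty_iff_ne_empty]⟩
  simp only [mem_filter, mem_powerset] at hΛ hmax
  obtain ⟨hΛS, hΛD, hΛN⟩ := hΛ
  have hcard := hbound Λ hΛS hΛD hΛN
  refine ⟨Λ, hΛS, hcard, fun γ hγ t => ?_⟩
  have hρ : 0 ≤ 4 * Q * ρ t := mul_nonneg (by positivity) (apply_nonneg ρ t)
  by_cases hγΛ : γ ∈ Λ
  · have : charSeminorm γ t ≤ ∑ χ ∈ Λ, charSeminorm χ t :=
      single_le_sum (f := fun χ => charSeminorm χ t) (fun χ _ => charSeminorm_nonneg χ t) hγΛ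
    linarith
  have hlt : #Λ < D := by
    have := hcard.trans_lt hD
    exact_mod_cast this
  have hnot : ¬ Dissociated N (insert γ Λ) := by
    intro hd
    have h2 := hmax (insert γ Λ) ⟨insert_subset hγ hΛS, by rw [card_insert_of_notMem hγΛ]; omega, hd⟩
    rw [card_insert_of_notMem hγΛ] at h2
    omega
  obtain ⟨T, hT, hγT, U, hU, hTU⟩ := hΛN.insert_witness hnot
  have h2 := charSeminorm_le_signedProd hγT hU t
  have h3 : ∑ χ ∈ T.erase γ, charSeminorm χ t ≤ ∑ χ ∈ Λ, charSeminorm χ t :=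
    sum_le_sum_of_subset_of_nonneg (subset_insert_iff.1 hT) fun _ _ _ => charSeminorm_nonneg _ _
  have h4 := hTU t
  linarith

end Spectrum

/-! ### Variation of an indicator function inside a translate of a Gibbs weight -/

section Variation

variable {G : Type*} [AddCommGroup G] [Fintype G]

/-- If a `{0,1}`-valued function `f` has intermediate average over a translate of `gibbs ρ`, then
for some `t` of moderate `ρ`-length the functions `f` and `f (· + t)` differ substantially with
respect to some weight tempered for `2 • ρ`. The weights used are `y ↦ b y * b (y + t)` with `b` the
translate in question: the law of `y` given that two independent samples `y`, `z` of `b` satisfy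
`z - y = t`. -/
theorem exists_tempered_le_sum_mul_sub {ρ : AddGroupSeminorm G} {f : G → ℝ}
    (hf : ∀ x, f x = 0 ∨ f x = 1) {δ : ℝ} (hδ : 0 < δ) (hδ1 : δ ≤ 1) {x : G}
    (h1 : δ / 2 ≤ ∑ y, gibbs ρ y * f (x + y)) (h2 : ∑ y, gibbs ρ y * f (x + y) ≤ 1 - δ / 2)
    {R : ℝ} (hR : 2 * (Fintype.card G * Real.exp (-R)) ≤ δ / 8) :
    ∃ t, ρ t ≤ 2 * R ∧ ∃ μ ∈ stdSimplex ℝ G, Tempered (2 • ρ) μ ∧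
      δ / 8 ≤ ∑ y, μ y * f y * (f y - f (y + t)) := by
  classical
  set b : G → ℝ := fun y => gibbs ρ (y - x) with hb
  have hb0 : ∀ y, 0 < b y := fun y => gibbs_pos ρ _
  have hb1 : ∑ y, b y = 1 := by
    rw [← (gibbs_mem_stdSimplex ρ).2]
    exact Equiv.sum_comp (Equiv.subRight x) (gibbs ρ)
  have hbf : ∑ y, b y * f y = ∑ y, gibbs ρ y * f (x + y) := by
    rw [← Equiv.sum_comp (Equiv.addLeft x)]
    refine sum_congr rfl fun y _ => ?_
    simp [hb]
  rw [← hbf] at h1 h2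
  have hbt : ∀ y s, b (y + s) ≤ Real.exp (ρ s) * b y := fun y s => by
    have := gibbs_tempered ρ (y - x) s
    rwa [sub_add_eq_add_sub] at this
  have hf0 : ∀ y, 0 ≤ f y := fun y => by rcases hf y with h | h <;> rw [h]; norm_num
  have hf1 : ∀ y, f y ≤ 1 := fun y => by rcases hf y with h | h <;> rw [h]; norm_num
  have hshift : ∀ (g : G → ℝ) y, ∑ t, g (y + t) = ∑ t, g t := fun g y =>
    Equiv.sum_comp (Equiv.addLeft y) g
  set W : G → ℝ := fun t => ∑ y, b y * b (y + t) with hW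
  set V : G → ℝ := fun t => ∑ y, b y * b (y + t) * (f y * (1 - f (y + t))) with hV
  have hWpos : ∀ t, 0 < W t := fun t => sum_pos (fun y _ => mul_pos (hb0 _) (hb0 _)) ⟨0, mem_univ _⟩
  have hVW : ∀ t, V t ≤ W t := fun t => sum_le_sum fun y _ => by
    refine mul_le_of_le_one_right (mul_pos (hb0 _) (hb0 _)).le ?_
    nlinarith [hf0 y, hf1 y, hf0 (y + t), hf1 (y + t)]
  have hWsum : ∑ t, W t = 1 := by
    simp only [hW]
    rw [sum_comm]
    simp only [← mul_sum, hshift b, hb1, mul_one]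
  have hVsum : ∑ t, V t = (∑ y, b y * f y) * (1 - ∑ y, b y * f y) := by
    have h3 : ∑ y, b y * (1 - f y) = 1 - ∑ y, b y * f y := by
      simp only [mul_sub, mul_one, sum_sub_distrib, hb1]
    simp only [hV]
    rw [sum_comm, ← h3, sum_mul]
    refine sum_congr rfl fun y _ => ?_
    rw [← hshift (fun t => b t * (1 - f t)) y, mul_sum]
    refine sum_congr rfl fun t _ => ?_
    ring
  have htail : ∑ y, (if R < ρ (y - x) then b y else 0) ≤ Fintype.card G * Real.exp (-R) := by
    refine le_trans (le_of_eq ?_) (sum_gibbs_tail_le ρ R)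
    rw [sum_filter, ← Equiv.sum_comp (Equiv.addRight x)]
    refine sum_congr rfl fun y _ => ?_
    simp [hb]
  set ind : G → ℝ := fun y => if R < ρ (y - x) then 1 else 0 with hind
  have hind0 : ∀ y, 0 ≤ ind y := fun y => by simp only [hind]; split_ifs <;> norm_num
  have htail' : ∑ y, b y * ind y ≤ Fintype.card G * Real.exp (-R) := by
    refine le_trans (le_of_eq (sum_congr rfl fun y _ => ?_)) htail
    simp [hind]
  set bad : G → ℝ := fun t => if 2 * R < ρ t then W t else 0 with hbad
  have hbadle : ∀ t, bad t ≤ ∑ y, b y * b (y + t) * (ind y + ind (y + t)) := by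
    intro t
    simp only [hbad]
    split_ifs with h
    · refine sum_le_sum fun y _ => le_mul_of_one_le_right (mul_pos (hb0 _) (hb0 _)).le ?_
      have h3 := map_sub_le_add ρ (y + t - x) (y - x)
      rw [sub_sub_sub_cancel_right, add_sub_cancel_left] at h3
      by_cases h4 : R < ρ (y - x)
      · have : ind y = 1 := by simp [hind, h4]
        linarith [hind0 (y + t)]
      · have : ind (y + t) = 1 := by
          have : R < ρ (y + t - x) := by linarith
          simp [hind, this]
        linarith [hind0 y]
    · exact sum_nonneg fun y _ => mul_nonneg (mul_pos (hb0 _) (hb0 _)).le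
        (add_nonneg (hind0 _) (hind0 _))
  have hbadsum : ∑ t, bad t ≤ δ / 8 := by
    calc ∑ t, bad t ≤ ∑ t, ∑ y, b y * b (y + t) * (ind y + ind (y + t)) :=
          sum_le_sum fun t _ => hbadle t
      _ = ∑ y, (b y * ind y + b y * ∑ t, b t * ind t) := by
          rw [sum_comm]
          refine sum_congr rfl fun y _ => ?_
          have h3 : ∀ t, b y * b (y + t) * (ind y + ind (y + t))
              = b y * ind y * b (y + t) + b y * (b (y + t) * ind (y + t)) := fun t => by ring
          simp only [h3, sum_add_distrib, ← mul_sum, hshift b, hb1, mul_one,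
            hshift fun t => b t * ind t]
      _ = 2 * ∑ y, b y * ind y := by
          rw [sum_add_distrib, ← sum_mul, hb1, one_mul, two_mul]
      _ ≤ δ / 8 := by linarith
  have hsum : ∑ t, δ / 8 * W t ≤ ∑ t, (V t - bad t) := by
    rw [← mul_sum, hWsum, sum_sub_distrib, hVsum]
    nlinarith
  obtain ⟨t, -, ht⟩ := exists_le_of_sum_le univ_nonempty hsum
  have htR : ρ t ≤ 2 * R := by
    by_contra hcon
    have h3 : bad t = W t := by simp only [hbad]; rw [if_pos (not_le.1 hcon)]
    have h4 := hVW t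
    have h5 := mul_pos (show 0 < δ / 8 by positivity) (hWpos t)
    linarith
  have hbad0 : bad t = 0 := by simp only [hbad]; rw [if_neg (not_lt.2 htR)]
  refine ⟨t, htR, fun y => b y * b (y + t) / W t,
    ⟨fun y => div_nonneg (mul_pos (hb0 _) (hb0 _)).le (hWpos t).le, ?_⟩, ?_, ?_⟩
  · rw [← sum_div]
    exact div_self (hWpos t).ne'
  · intro y s
    have h3 : (2 • ρ) s = ρ s + ρ s := by rw [two_nsmul]; simp
    have hWt := hWpos t
    simp only
    rw [h3, Real.exp_add, ← mul_div_assoc]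
    refine div_le_div_of_nonneg_right ?_ hWt.le
    have h4 := hbt y s
    have h5 := hbt (y + t) s
    rw [add_right_comm y s t]
    calc b (y + s) * b (y + t + s) ≤ (Real.exp (ρ s) * b y) * (Real.exp (ρ s) * b (y + t)) :=
          mul_le_mul h4 h5 (hb0 _).le (mul_nonneg (Real.exp_pos _).le (hb0 _).le)
      _ = _ := by ring
  · have h3 : ∑ y, b y * b (y + t) / W t * f y * (f y - f (y + t)) = V t / W t := by
      simp only [hV]
      rw [sum_div]
      refine sum_congr rfl fun y _ => ?_
      have h4 : f y * (f y - f (y + t)) = f y * (1 - f (y + t)) := by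
        rcases hf y with h | h <;> rw [h]; ring
      rw [mul_assoc, h4]
      ring
    rw [h3, le_div_iff₀ (hWpos t)]
    linarith

end Variation

/-! ### Selecting a level of the spectrum -/

section Levels

theorem le_add_sum_ite_le {b : ℝ} (hb : b ≤ 1) (N : ℕ) :
    b ≤ (1 / 2) ^ N + ∑ i ∈ range N, (1 / 2) ^ i * (if (1 / 2) ^ (i + 1) ≤ b then 1 else 0) := by
  have hnn : ∀ N, 0 ≤ ∑ i ∈ range N, (1 / 2 : ℝ) ^ i *
      (if (1 / 2) ^ (i + 1) ≤ b then 1 else 0) := fun N =>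
    sum_nonneg fun i _ => by split_ifs <;> positivity
  induction N with
  | zero => simpa using hb
  | succ N ih =>
    by_cases h : (1 / 2) ^ (N + 1) ≤ b
    · rw [sum_range_succ, if_pos h]
      have : (0 : ℝ) < (1 / 2) ^ (N + 1) := by positivity
      linarith
    · linarith [hnn (N + 1)]

/-- Dyadic pigeonholing with the weights `1 / (2 * N) + 2 ^ (-i) / 4`, whose sum over `i < N` is
at most `1`: the first summand gives a mass proportional to `2 ^ i / N`, the second a mass bounded
below independently of `i` and `N`. -/
theorem exists_level {ι : Type*} (K : Finset ι) {a b : ι → ℝ} (ha : ∀ γ, 0 ≤ a γ)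
    (hb1 : ∀ γ, b γ ≤ 1) {η : ℝ} {N : ℕ} (hN : 0 < N)
    (hab : 2 * η ≤ ∑ γ ∈ K, a γ * b γ) (hη : (∑ γ ∈ K, a γ) * (1 / 2) ^ N ≤ η) :
    ∃ i < N, η / 4 ≤ ∑ γ ∈ K with (1 / 2) ^ (i + 1) ≤ b γ, a γ ∧
      η * 2 ^ i / (2 * N) ≤ ∑ γ ∈ K with (1 / 2) ^ (i + 1) ≤ b γ, a γ := by
  have hN' : (0 : ℝ) < N := by exact_mod_cast hN
  have hη0 : 0 ≤ η := le_trans (mul_nonneg (sum_nonneg fun γ _ => ha γ) (by positivity)) hη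
  set m : ℕ → ℝ := fun i => ∑ γ ∈ K with (1 / 2) ^ (i + 1) ≤ b γ, a γ with hm
  have h1 : η ≤ ∑ i ∈ range N, (1 / 2) ^ i * m i := by
    have h2 : ∑ γ ∈ K, a γ * b γ ≤ (∑ γ ∈ K, a γ) * (1 / 2) ^ N
        + ∑ i ∈ range N, (1 / 2) ^ i * m i := by
      calc ∑ γ ∈ K, a γ * b γ ≤ ∑ γ ∈ K, a γ * ((1 / 2) ^ N + ∑ i ∈ range N,
            (1 / 2) ^ i * (if (1 / 2) ^ (i + 1) ≤ b γ then 1 else 0)) :=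
            sum_le_sum fun γ _ => mul_le_mul_of_nonneg_left (le_add_sum_ite_le (hb1 γ) N) (ha γ)
        _ = _ := by
            simp only [mul_add, sum_add_distrib, hm, sum_filter, mul_sum, sum_mul]
            congr 1
            rw [sum_comm]
            refine sum_congr rfl fun i _ => sum_congr rfl fun γ _ => ?_
            split_ifs <;> ring
    linarith
  have h2 : ∑ i ∈ range N, η * (1 / (2 * N) + (1 / 2) ^ i / 4) ≤ ∑ i ∈ range N, (1 / 2) ^ i * m i := by
    refine le_trans ?_ h1
    rw [← mul_sum, sum_add_distrib, sum_const, card_range, nsmul_eq_mul, ← sum_div]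
    have h3 : ∑ i ∈ range N, (1 / 2 : ℝ) ^ i ≤ 2 := sum_geometric_two_le N
    have h4 : (N : ℝ) * (1 / (2 * N)) = 1 / 2 := by field_simp
    rw [h4]
    exact mul_le_of_le_one_right hη0 (by linarith)
  obtain ⟨i, hi, hle⟩ := exists_le_of_sum_le (nonempty_range_iff.2 hN.ne') h2
  have h5 : (2 : ℝ) ^ i * (1 / 2) ^ i = 1 := by rw [← mul_pow]; norm_num
  have h6 : η * (2 ^ i / (2 * N) + 1 / 4) ≤ m i := by
    have h7 := mul_le_mul_of_nonneg_left hle (show (0 : ℝ) ≤ 2 ^ i by positivity)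
    rw [← mul_assoc (2 ^ i) ((1 / 2) ^ i), h5, one_mul] at h7
    refine le_trans (le_of_eq ?_) h7
    linear_combination (-(η / 4)) * h5
  have h8 : 0 ≤ η * (2 ^ i / (2 * N)) := by positivity
  refine ⟨i, mem_range.1 hi, ?_, ?_⟩
  · linarith
  · rw [mul_div_assoc]
    linarith

end Levels

/-! ### Capturing a further part of the spectral mass -/

section Increment

variable {G : Type*} [AddCommGroup G] [Fintype G]

open Classical in
/-- The characters captured by a seminorm `ρ`: those `χ` with `|1 - χ(t)| ≤ ρ(t)` for all `t`. -/
noncomputable def captured (ρ : AddGroupSeminorm G) : Finset (AddChar G ℂ) :=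
  univ.filter fun χ => ∀ t, charSeminorm χ t ≤ ρ t

theorem mem_captured {ρ : AddGroupSeminorm G} {χ : AddChar G ℂ} :
    χ ∈ captured ρ ↔ ∀ t, charSeminorm χ t ≤ ρ t := by
  simp [captured]

/-- The part of the `A(G)`-norm of `f` carried by the characters captured by `ρ`. -/
noncomputable def capturedMass (f : G → ℂ) (ρ : AddGroupSeminorm G) : ℝ :=
  ∑ χ ∈ captured ρ, ‖fourierCoeffFin f χ‖

theorem capturedMass_le_wienerNorm (f : G → ℂ) (ρ : AddGroupSeminorm G) :
    capturedMass f ρ ≤ wienerNorm f :=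
  sum_le_sum_of_subset_of_nonneg (subset_univ _) fun _ _ _ => norm_nonneg _

theorem norm_sum_mul_char_le_one {μ f : G → ℝ} (hμ : μ ∈ stdSimplex ℝ G) (hf : ∀ x, |f x| ≤ 1)
    (γ : AddChar G ℂ) : ‖∑ y, (μ y : ℂ) * f y * γ y‖ ≤ 1 := by
  rw [← hμ.2]
  refine (norm_sum_le _ _).trans (sum_le_sum fun y _ => ?_)
  rw [norm_mul, norm_mul, γ.norm_apply, mul_one, Complex.norm_real, Complex.norm_real,
    Real.norm_of_nonneg (hμ.1 y)]
  exact mul_le_of_le_one_right (hμ.1 y) (hf y)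

theorem sum_mul_sub_translate_le (f μ : G → ℝ) (t : G) :
    ∑ y, μ y * f y * (f y - f (y + t)) ≤ ∑ γ : AddChar G ℂ,
      ‖fourierCoeffFin (fun x => (f x : ℂ)) γ‖ * charSeminorm γ t *
        ‖∑ y, (μ y : ℂ) * f y * γ y‖ := by
  have h : ((∑ y, μ y * f y * (f y - f (y + t)) : ℝ) : ℂ) = ∑ γ : AddChar G ℂ,
      fourierCoeffFin (fun x => (f x : ℂ)) γ * (1 - γ t) * ∑ y, (μ y : ℂ) * f y * γ y := by
    simp only [mul_sum]
    rw [sum_comm]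
    push_cast
    refine sum_congr rfl fun y _ => ?_
    have h1 := sum_fourierCoeffFin_mul (fun x => (f x : ℂ)) y
    have h2 := sum_fourierCoeffFin_mul (fun x => (f x : ℂ)) (y + t)
    nth_rewrite 2 [← h1]
    rw [← h2, ← sum_sub_distrib, mul_sum]
    refine sum_congr rfl fun γ _ => ?_
    rw [AddChar.map_add_eq_mul]
    ring
  calc ∑ y, μ y * f y * (f y - f (y + t))
      ≤ ‖((∑ y, μ y * f y * (f y - f (y + t)) : ℝ) : ℂ)‖ := by
        rw [Complex.norm_real]
        exact le_abs_self _
    _ ≤ _ := by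
        rw [h]
        refine (norm_sum_le _ _).trans (le_of_eq (sum_congr rfl fun γ _ => ?_))
        rw [norm_mul, norm_mul, charSeminorm_apply]

/-- If `f` and its translate by `t` differ with respect to `μ`, where `t` is too short for the
captured characters to matter, then uncaptured characters have to be correlated with `f`. -/
theorem le_sum_compl_captured [DecidableEq (AddChar G ℂ)] {ρ : AddGroupSeminorm G} {f μ : G → ℝ}
    {t : G} {κ ε : ℝ} (hμ : μ ∈ stdSimplex ℝ G) (hf : ∀ x, |f x| ≤ 1) (hρ : ρ t ≤ ε)
    (hκ : wienerNorm (fun x => (f x : ℂ)) * ε ≤ κ)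
    (h : 2 * κ ≤ ∑ y, μ y * f y * (f y - f (y + t))) :
    κ / 2 ≤ ∑ γ ∈ (captured ρ)ᶜ, ‖fourierCoeffFin (fun x => (f x : ℂ)) γ‖ *
      ‖∑ y, (μ y : ℂ) * f y * γ y‖ := by
  set a : AddChar G ℂ → ℝ := fun γ => ‖fourierCoeffFin (fun x => (f x : ℂ)) γ‖ with ha
  set F : AddChar G ℂ → ℝ := fun γ => ‖∑ y, (μ y : ℂ) * f y * γ y‖ with hF
  have hF1 : ∀ γ, F γ ≤ 1 := norm_sum_mul_char_le_one hμ hf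
  have hε : 0 ≤ ε := (apply_nonneg ρ t).trans hρ
  have h1 := h.trans (sum_mul_sub_translate_le f μ t)
  rw [← sum_add_sum_compl (captured ρ)] at h1
  have h2 : ∑ γ ∈ captured ρ, a γ * charSeminorm γ t * F γ ≤ κ := by
    calc ∑ γ ∈ captured ρ, a γ * charSeminorm γ t * F γ ≤ ∑ γ ∈ captured ρ, a γ * ε := by
          refine sum_le_sum fun γ hγ => ?_
          have h3 := (mem_captured.1 hγ t).trans hρ
          refine (mul_le_of_le_one_right
            (mul_nonneg (norm_nonneg _) (charSeminorm_nonneg γ t)) (hF1 γ)).trans ?_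
          exact mul_le_mul_of_nonneg_left h3 (norm_nonneg _)
      _ ≤ κ := by
          rw [← sum_mul]
          exact (mul_le_mul_of_nonneg_right (capturedMass_le_wienerNorm _ ρ) hε).trans hκ
  have h4 : ∑ γ ∈ (captured ρ)ᶜ, a γ * charSeminorm γ t * F γ
      ≤ 2 * ∑ γ ∈ (captured ρ)ᶜ, a γ * F γ := by
    rw [mul_sum]
    refine sum_le_sum fun γ _ => ?_
    have h5 : 0 ≤ a γ * F γ := mul_nonneg (norm_nonneg _) (norm_nonneg _)
    nlinarith [charSeminorm_le_two γ t]
  linarith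

theorem pow_le_exp_of_six_le {n : ℕ} (hn : 6 ≤ n) :
    ((2 : ℝ) ^ n) ^ 10 ≤ Real.exp (2 ^ n) := by
  have h1 : 10 * n ≤ 2 ^ n := by
    induction n, hn using Nat.le_induction with
    | base => norm_num
    | succ n hn ih => rw [pow_succ]; omega
  calc ((2 : ℝ) ^ n) ^ 10 = 2 ^ (10 * n) := by rw [← pow_mul, mul_comm]
    _ ≤ Real.exp 1 ^ (10 * n) := by
        gcongr
        linarith [Real.exp_one_gt_d9]
    _ ≤ Real.exp 1 ^ (2 ^ n) := pow_le_pow_right₀ (Real.one_le_exp zero_le_one) h1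
    _ = Real.exp (2 ^ n) := by rw [← Real.exp_nat_mul]; push_cast; rw [mul_one]

/-- The smoothing error in `exists_card_le_and_charSeminorm_le` is small for `D = X ^ 4`,
`Q = X ^ 12`, `R = 2 * X`. -/
theorem smoothing_error_le {X : ℝ} (hX : 64 ≤ X) (hexp : X ^ 10 ≤ Real.exp X) :
    2 * X ^ 4 * ((Real.exp (2 * X / X ^ 12) - 1) + 2 * Real.exp (-X)) ≤ 1 / X ^ 2 / 2 := by
  have hX0 : 0 < X := by linarith
  have h1 : 2 * X / X ^ 12 = 2 / X ^ 11 := by field_simp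
  have h2 : Real.exp (2 * X / X ^ 12) - 1 ≤ 4 / X ^ 10 := by
    have h0 : 0 ≤ 2 / X ^ 11 := by positivity
    have h3 : 2 / X ^ 11 ≤ 2 / X ^ 10 := by
      gcongr 2 / ?_
      exact pow_le_pow_right₀ (by linarith) (by norm_num)
    have h4 : 2 / X ^ 10 ≤ 1 := by
      rw [div_le_one (by positivity)]
      calc (2 : ℝ) ≤ X := by linarith
        _ = X ^ 1 := (pow_one X).symm
        _ ≤ X ^ 10 := pow_le_pow_right₀ (by linarith) (by norm_num)
    have h5 : |2 / X ^ 11| ≤ 1 := by rw [abs_of_nonneg h0]; linarith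
    have h6 := Real.abs_exp_sub_one_le h5
    rw [abs_of_nonneg h0] at h6
    rw [h1]
    calc _ ≤ 2 * (2 / X ^ 11) := (le_abs_self _).trans h6
      _ ≤ 2 * (2 / X ^ 10) := by linarith
      _ = 4 / X ^ 10 := by ring
  have h7 : Real.exp (-X) ≤ 1 / X ^ 10 := by
    rw [Real.exp_neg, ← one_div]
    exact one_div_le_one_div_of_le (by positivity) hexp
  calc 2 * X ^ 4 * ((Real.exp (2 * X / X ^ 12) - 1) + 2 * Real.exp (-X))
      ≤ 2 * X ^ 4 * (4 / X ^ 10 + 2 * (1 / X ^ 10)) := by gcongr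
    _ = 12 / X ^ 6 := by field_simp; norm_num
    _ ≤ 1 / X ^ 2 / 2 := by
        rw [div_div, div_le_div_iff₀ (by positivity) (by positivity)]
        have h8 : (64 : ℝ) ^ 4 ≤ X ^ 4 := by gcongr
        have h9 : 0 < X ^ 2 := by positivity
        nlinarith

/-- One step of the iteration. If `f` is the indicator function of a set having intermediate average
over a translate of a suitable fine-scale Gibbs weight, then adding few characters to a multiple of
`ρ` captures a further mass `g` of the spectrum. The mass is at least a constant, which bounds the
number of steps, while the number of new characters is controlled by `g`, which bounds their total
number. -/
theorem exists_capturedMass_increment {f : G → ℝ} (hf : ∀ x, f x = 0 ∨ f x = 1) {δ : ℝ}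
    (hδ : 0 < δ) (hδ1 : δ ≤ 1) {n : ℕ} (hn : 6 ≤ n) (hnδ : 64 / δ ≤ 2 ^ n)
    (hG : Real.log (Fintype.card G) ≤ 2 ^ n) (hM : wienerNorm (fun x => (f x : ℂ)) ≤ 2 ^ n)
    (ρ : AddGroupSeminorm G) {x : G}
    (h1 : δ / 2 ≤ ∑ y, gibbs ((2 ^ n) ^ 3 • ρ) y * f (x + y))
    (h2 : ∑ y, gibbs ((2 ^ n) ^ 3 • ρ) y * f (x + y) ≤ 1 - δ / 2) :
    ∃ (Λ : Finset (AddChar G ℂ)) (g : ℝ), δ / 256 ≤ g ∧ (#Λ : ℝ) ≤ 8192 * n ^ 2 / δ * g ∧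
      capturedMass (fun x => (f x : ℂ)) ρ + g ≤ capturedMass (fun x => (f x : ℂ))
        ((8 * (2 ^ n) ^ 15) • ρ + ∑ χ ∈ Λ, charSeminorm χ) := by
  classical
  set X : ℝ := 2 ^ n with hX
  have hX64 : 64 ≤ X := by
    calc (64 : ℝ) = 2 ^ 6 := by norm_num
      _ ≤ X := pow_le_pow_right₀ (by norm_num) hn
  have hX0 : 0 < X := by linarith
  have hnX : (n : ℝ) ≤ X := by
    rw [hX]
    exact_mod_cast n.lt_two_pow_self.le
  have hXδ : 64 ≤ δ * X := by
    rw [div_le_iff₀ hδ] at hnδ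
    linarith
  have hexp := pow_le_exp_of_six_le hn
  rw [← hX] at hexp
  have habs : ∀ x, |f x| ≤ 1 := fun x => by rcases hf x with h | h <;> rw [h] <;> simp
  -- the Gibbs weight beyond radius `R = 2 * X` is negligible since `log |G| ≤ X`
  have htail : Fintype.card G * Real.exp (-(2 * X)) ≤ Real.exp (-X) := by
    have hc : (0 : ℝ) < Fintype.card G := by exact_mod_cast Fintype.card_pos
    calc Fintype.card G * Real.exp (-(2 * X))
        = Real.exp (Real.log (Fintype.card G) + -(2 * X)) := by
          rw [Real.exp_add, Real.exp_log hc]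
      _ ≤ Real.exp (-X) := Real.exp_le_exp.2 (by linarith)
  have hexpX : Real.exp (-X) ≤ 1 / X := by
    rw [Real.exp_neg, ← one_div]
    refine one_div_le_one_div_of_le hX0 (le_trans ?_ hexp)
    calc X = X ^ 1 := (pow_one X).symm
      _ ≤ X ^ 10 := pow_le_pow_right₀ (by linarith) (by norm_num)
  have hXinv : 1 / X ≤ δ / 64 := by
    rw [div_le_div_iff₀ hX0 (by norm_num)]
    linarith
  set τ : AddGroupSeminorm G := (2 ^ n) ^ 3 • ρ with hτ
  have hτa : ∀ t, τ t = X ^ 3 * ρ t := fun t => by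
    rw [hτ]; simp [hX]
  obtain ⟨t, ht, μ, hμ, hμτ, hvar⟩ := exists_tempered_le_sum_mul_sub (ρ := τ) hf hδ hδ1 h1 h2
    (R := 2 * X) (by linarith)
  have hρt : ρ t ≤ 4 / X ^ 2 := by
    rw [hτa] at ht
    rw [le_div_iff₀ (by positivity)]
    have h3 : X * (ρ t * X ^ 2) ≤ X * 4 := by linarith
    exact le_of_mul_le_mul_left h3 hX0
  have hunc := le_sum_compl_captured (κ := δ / 16) hμ habs hρt (by
    calc wienerNorm (fun x => (f x : ℂ)) * (4 / X ^ 2) ≤ X * (4 / X ^ 2) := by gcongr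
      _ = 4 * (1 / X) := by field_simp
      _ ≤ δ / 16 := by linarith) (by linarith)
  have hmassX : ∑ γ ∈ (captured ρ)ᶜ, ‖fourierCoeffFin (fun x => (f x : ℂ)) γ‖ ≤ X :=
    (sum_le_sum_of_subset_of_nonneg (subset_univ _) fun _ _ _ => norm_nonneg _).trans hM
  have hhalf : (1 / 2 : ℝ) ^ (2 * n) = 1 / X ^ 2 := by
    rw [hX, ← pow_mul, mul_comm n 2, one_div_pow]
  obtain ⟨i, hi, hg1, hg2⟩ := exists_level (captured ρ)ᶜ
    (a := fun γ => ‖fourierCoeffFin (fun x => (f x : ℂ)) γ‖)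
    (b := fun γ => ‖∑ y, (μ y : ℂ) * f y * γ y‖) (fun _ => norm_nonneg _)
    (norm_sum_mul_char_le_one hμ habs)
    (η := δ / 64) (N := 2 * n) (by omega) (by linarith) (by
      rw [hhalf]
      calc _ ≤ X * (1 / X ^ 2) := by gcongr
        _ = 1 / X := by field_simp
        _ ≤ δ / 64 := hXinv)
  set S := (captured ρ)ᶜ.filter fun γ => (1 / 2 : ℝ) ^ (i + 1) ≤ ‖∑ y, (μ y : ℂ) * f y * γ y‖
    with hS
  set g : ℝ := ∑ γ ∈ S, ‖fourierCoeffFin (fun x => (f x : ℂ)) γ‖ with hg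
  set s : ℝ := (1 / 2) ^ (i + 1) with hs
  have hs0 : 0 < s := by positivity
  have hsX : 1 / X ^ 2 ≤ s := by
    rw [← hhalf]
    exact pow_le_pow_of_le_one (by norm_num) (by norm_num) (by omega)
  have hns : 16 * n / s = 32 * n * 2 ^ i := by
    rw [hs, one_div_pow, div_div_eq_mul_div, div_one, pow_succ]
    ring
  have hD : 16 * n / s < ((2 ^ n) ^ 4 : ℕ) := by
    push_cast
    rw [← hX, div_lt_iff₀ hs0]
    have h3 : X ^ 2 ≤ X ^ 4 * s := by
      calc X ^ 2 = X ^ 4 * (1 / X ^ 2) := by field_simp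
        _ ≤ X ^ 4 * s := by gcongr
    nlinarith
  obtain ⟨Λ, -, hΛ, hspec⟩ := exists_card_le_and_charSeminorm_le hμτ hμ habs (n := n) (by omega) hM
    hs0 (D := (2 ^ n) ^ 4) (Q := (2 ^ n) ^ 12) (by positivity) hD (R := 2 * X) (by positivity) (by
      push_cast
      rw [← hX]
      calc _ ≤ 2 * X ^ 4 * ((Real.exp (2 * X / X ^ 12) - 1) + 2 * Real.exp (-X)) := by gcongr
        _ ≤ 1 / X ^ 2 / 2 := smoothing_error_le hX64 hexp
        _ ≤ s / 2 := by linarith) S (fun γ hγ => (mem_filter.1 hγ).2)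
  refine ⟨Λ, g, by linarith, ?_, ?_⟩
  · have hn0 : (0 : ℝ) < n := by exact_mod_cast (by omega : 0 < n)
    have h3 : (2 : ℝ) ^ i ≤ 256 * n / δ * g := by
      push_cast at hg2
      rw [div_le_iff₀ (by positivity)] at hg2
      rw [div_mul_eq_mul_div, le_div_iff₀ hδ]
      linarith
    rw [hns] at hΛ
    calc (#Λ : ℝ) ≤ 32 * n * 2 ^ i := hΛ
      _ ≤ 32 * n * (256 * n / δ * g) := by gcongr
      _ = 8192 * n ^ 2 / δ * g := by ring
  · have hdisj : Disjoint (captured ρ) S :=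
      disjoint_compl_right.mono_right (filter_subset _ _)
    rw [capturedMass, hg, ← sum_union hdisj]
    refine sum_le_sum_of_subset_of_nonneg ?_ fun _ _ _ => norm_nonneg _
    have happ : ∀ t, ((8 * (2 ^ n) ^ 15) • ρ + ∑ χ ∈ Λ, charSeminorm χ : AddGroupSeminorm G) t
        = 8 * X ^ 15 * ρ t + ∑ χ ∈ Λ, charSeminorm χ t := fun t => by
      simp [hX]
    have hX15 : 1 ≤ 8 * X ^ 15 := by
      have : 1 ≤ X ^ 15 := one_le_pow₀ (by linarith)
      linarith
    refine union_subset (fun γ hγ => mem_captured.2 fun t => ?_)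
      (fun γ hγ => mem_captured.2 fun t => ?_)
    · rw [happ]
      have h3 := mem_captured.1 hγ t
      have h4 : 0 ≤ ∑ χ ∈ Λ, charSeminorm χ t := sum_nonneg fun _ _ => charSeminorm_nonneg _ _
      have h5 := le_mul_of_one_le_left (apply_nonneg ρ t) hX15
      linarith
    · rw [happ]
      refine (hspec γ hγ t).trans (le_of_eq ?_)
      have h3 : (2 • τ) t = 2 * (X ^ 3 * ρ t) := by
        rw [← hτa]; simp
      rw [h3]
      push_cast
      rw [← hX]
      ring

end Increment

/-! ### Simultaneous approximation and the discrete intermediate value principle -/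

section Pigeonhole

variable {G : Type*} [AddCommGroup G] [Fintype G]

theorem abs_sub_le_of_floor_eq {m : ℕ} (hm : 0 < m) {a b : ℝ} (h : ⌊m * a⌋ = ⌊m * b⌋) :
    |a - b| ≤ 1 / m := by
  have hm' : (0 : ℝ) < m := by exact_mod_cast hm
  have h1 := (Int.abs_sub_lt_one_of_floor_eq_floor h).le
  rw [← mul_sub, abs_mul, abs_of_pos hm'] at h1
  rw [le_div_iff₀ hm']
  linarith

/-- Dirichlet's simultaneous approximation principle for characters. -/
theorem exists_ne_zero_charSeminorm_le (Γ : Finset (AddChar G ℂ)) {m : ℕ} (hm : 0 < m)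
    (h : (2 * m + 1) ^ (2 * #Γ) < Fintype.card G) :
    ∃ t : G, t ≠ 0 ∧ ∀ χ ∈ Γ, charSeminorm χ t ≤ 2 / m := by
  classical
  have hm' : (0 : ℝ) < m := by exact_mod_cast hm
  -- the cell of `t` records real and imaginary parts of all `χ t` up to precision `1 / m`
  set box : Finset (Γ → ℤ × ℤ) :=
    Fintype.piFinset fun _ => Icc (-(m : ℤ)) m ×ˢ Icc (-(m : ℤ)) m with hbox
  have hcard : #box < #(univ : Finset G) := by
    rw [hbox, Fintype.card_piFinset, prod_const, card_product, Int.card_Icc, card_univ, card_univ,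
      Fintype.card_coe, ← sq, ← pow_mul]
    convert h using 2
    omega
  have hfl : ∀ a : ℝ, |a| ≤ 1 → ⌊m * a⌋ ∈ Icc (-(m : ℤ)) m := by
    intro a ha
    rw [abs_le] at ha
    rw [mem_Icc]
    constructor
    · rw [Int.le_floor]
      push_cast
      nlinarith
    · have h1 : (⌊m * a⌋ : ℝ) ≤ m := (Int.floor_le _).trans (by nlinarith)
      exact_mod_cast h1
  obtain ⟨s, -, t, -, hst, heq⟩ := exists_ne_map_eq_of_card_lt_of_maps_to hcard
    (f := fun t (χ : Γ) => (⌊m * (χ.1 t).re⌋, ⌊m * (χ.1 t).im⌋)) (by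
      intro t _
      simp only [hbox, mem_coe, Fintype.mem_piFinset, mem_product]
      intro χ
      have h1 := Complex.abs_re_le_norm (χ.1 t)
      have h2 := Complex.abs_im_le_norm (χ.1 t)
      rw [AddChar.norm_apply] at h1 h2
      exact ⟨hfl _ h1, hfl _ h2⟩)
  refine ⟨s - t, sub_ne_zero.2 hst, fun χ hχ => ?_⟩
  have h1 := congrFun heq ⟨χ, hχ⟩
  simp only [Prod.mk.injEq] at h1
  have h2 : charSeminorm χ (s - t) = ‖χ t - χ s‖ := by
    rw [charSeminorm_apply, ← one_mul ‖1 - χ (s - t)‖, ← χ.norm_apply t, ← norm_mul, mul_sub,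
      mul_one, ← AddChar.map_add_eq_mul, add_sub_cancel]
  rw [h2, norm_sub_rev]
  refine (Complex.norm_le_abs_re_add_abs_im _).trans ?_
  rw [Complex.sub_re, Complex.sub_im]
  have h3 := abs_sub_le_of_floor_eq hm h1.1
  have h4 := abs_sub_le_of_floor_eq hm h1.2
  have h5 : (2 : ℝ) / m = 1 / m + 1 / m := by ring
  linarith

end Pigeonhole

section IntermediateValue

/-- A real function on `ℤ/p` that changes by at most `ε` under translation by some `t ≠ 0` comes
within `ε` of its mean. -/
theorem exists_abs_sub_mean_le {p : ℕ} [Fact p.Prime] {h : ZMod p → ℝ} {t : ZMod p} (ht : t ≠ 0)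
    {ε α : ℝ} (hε : 0 ≤ ε) (hstep : ∀ x, |h (x + t) - h x| ≤ ε) (hα : ∑ x, h x = p * α) :
    ∃ x, |h x - α| ≤ ε := by
  classical
  have hc : ∑ _x : ZMod p, α = p * α := by simp [ZMod.card]
  obtain ⟨x₁, -, h1⟩ := exists_le_of_sum_le (s := univ) (f := h) (g := fun _ => α) univ_nonempty
    (by rw [hα, hc])
  obtain ⟨x₂, -, h2⟩ := exists_le_of_sum_le (s := univ) (f := fun _ => α) (g := h) univ_nonempty
    (by rw [hα, hc])
  have hex : ∃ n : ℕ, α ≤ h (x₁ + n * t) := by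
    refine ⟨((x₂ - x₁) / t).val, ?_⟩
    rw [ZMod.natCast_zmod_val, div_mul_cancel₀ _ ht, add_sub_cancel]
    exact h2
  have hn := Nat.find_spec hex
  rcases hk : Nat.find hex with _ | k
  · rw [hk] at hn
    refine ⟨x₁, ?_⟩
    simp only [Nat.cast_zero, zero_mul, add_zero] at hn
    rw [abs_of_nonneg (by linarith)]
    linarith
  · have hlt : h (x₁ + k * t) < α := not_le.1 (Nat.find_min hex (by omega))
    rw [hk] at hn
    have h3 := hstep (x₁ + k * t)
    have h4 : x₁ + k * t + t = x₁ + ((k + 1 : ℕ) : ZMod p) * t := by push_cast; ring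
    rw [h4] at h3
    refine ⟨x₁ + ((k + 1 : ℕ) : ZMod p) * t, ?_⟩
    rw [abs_of_nonneg (by linarith)]
    linarith [(abs_le.1 h3).2]

/-- A function with values in `[0, 1]` and mean in `[δ, 1 - δ]` has intermediate average over some
translate of `gibbs ρ`, as soon as `ρ` is small at some nonzero point. -/
theorem exists_gibbs_average_mem {p : ℕ} [Fact p.Prime] (ρ : AddGroupSeminorm (ZMod p))
    {f : ZMod p → ℝ} (hf : ∀ x, |f x| ≤ 1) {δ α : ℝ} (hδ : 0 < δ) (h1 : δ ≤ α)
    (h2 : α ≤ 1 - δ) (hα : ∑ x, f x = p * α) {t : ZMod p} (ht : t ≠ 0) (hρ : ρ t ≤ δ / 4) :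
    ∃ x, δ / 2 ≤ ∑ y, gibbs ρ y * f (x + y) ∧ ∑ y, gibbs ρ y * f (x + y) ≤ 1 - δ / 2 := by
  set h : ZMod p → ℝ := fun x => ∑ y, gibbs ρ y * f (x + y) with hh
  have hmean : ∑ x, h x = p * α := by
    simp only [hh]
    rw [sum_comm, ← hα, ← one_mul (∑ x, f x), ← (gibbs_mem_stdSimplex ρ).2, sum_mul]
    refine sum_congr rfl fun y _ => ?_
    rw [← mul_sum]
    congr 1
    exact Equiv.sum_comp (Equiv.addRight y) f
  have hstep : ∀ x, |h (x + t) - h x| ≤ δ / 2 := by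
    intro x
    have h3 : h (x + t) = ∑ y, gibbs ρ (y + -t) * f (x + y) := by
      simp only [hh]
      rw [← Equiv.sum_comp (Equiv.addRight t) fun y => gibbs ρ (y + -t) * f (x + y)]
      refine sum_congr rfl fun y _ => ?_
      simp only [Equiv.coe_addRight, add_neg_cancel_right]
      congr 2
      ring
    rw [h3]
    simp only [hh]
    rw [← sum_sub_distrib]
    calc |∑ y, (gibbs ρ (y + -t) * f (x + y) - gibbs ρ y * f (x + y))|
        ≤ ∑ y, |gibbs ρ (y + -t) - gibbs ρ y| := by
          refine (abs_sum_le_sum_abs _ _).trans (sum_le_sum fun y _ => ?_)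
          rw [← sub_mul, abs_mul]
          exact mul_le_of_le_one_right (abs_nonneg _) (hf _)
      _ ≤ Real.exp (ρ (-t)) - 1 :=
          (gibbs_tempered ρ).sum_abs_sub_le (gibbs_mem_stdSimplex ρ) _
      _ ≤ δ / 2 := by
          rw [map_neg_eq_map]
          have h4 : 0 ≤ ρ t := apply_nonneg ρ t
          have h5 : |ρ t| ≤ 1 := by rw [abs_of_nonneg h4]; linarith
          have h6 := Real.abs_exp_sub_one_le h5
          rw [abs_of_nonneg h4] at h6
          linarith [le_abs_self (Real.exp (ρ t) - 1)]
  obtain ⟨x, hx⟩ := exists_abs_sub_mean_le ht (by positivity) hstep hmean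
  rw [abs_le] at hx
  exact ⟨x, by linarith, by linarith⟩

end IntermediateValue

/-! ### The iteration -/

section Iteration

/-- As long as the simultaneous approximation principle applies, the iteration can be continued:
after `j` steps the captured mass is at least `j * δ / 256`. -/
theorem exists_capturedMass_ge {p : ℕ} [Fact p.Prime] {f : ZMod p → ℝ}
    (hf : ∀ x, f x = 0 ∨ f x = 1) {δ α : ℝ} (hδ : 0 < δ) (hδ1 : δ ≤ 1) (h1 : δ ≤ α)
    (h2 : α ≤ 1 - δ) (hα : ∑ x, f x = p * α) {n : ℕ} (hn : 6 ≤ n) (hnδ : 64 / δ ≤ 2 ^ n)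
    (hp : Real.log p ≤ 2 ^ n) (hM : wienerNorm (fun x => (f x : ℂ)) ≤ 2 ^ n)
    (hlog : ∀ j d : ℕ, j * (δ / 256) ≤ wienerNorm (fun x => (f x : ℂ)) →
      d ≤ 8192 * n ^ 2 / δ * wienerNorm (fun x => (f x : ℂ)) →
      ((2 + 10 * n + (15 * n + 4) * j) * (2 * d) : ℕ) < Real.log p) (j : ℕ) :
    ∃ (ρ : AddGroupSeminorm (ZMod p)) (Γ : Finset (AddChar (ZMod p) ℂ)),
      j * (δ / 256) ≤ capturedMass (fun x => (f x : ℂ)) ρ ∧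
      (#Γ : ℝ) ≤ 8192 * n ^ 2 / δ * capturedMass (fun x => (f x : ℂ)) ρ ∧
      ∀ t, ρ t ≤ 2 ^ ((15 * n + 4) * j) * ∑ χ ∈ Γ, charSeminorm χ t := by
  classical
  set M := wienerNorm (fun x => (f x : ℂ)) with hMdef
  have hM0 : 0 ≤ M := sum_nonneg fun _ _ => norm_nonneg _
  have habs : ∀ x, |f x| ≤ 1 := fun x => by rcases hf x with h | h <;> rw [h] <;> simp
  induction j with
  | zero =>
    have h0 : 0 ≤ capturedMass (fun x => (f x : ℂ)) (0 : AddGroupSeminorm (ZMod p)) :=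
      sum_nonneg fun _ _ => norm_nonneg _
    exact ⟨0, ∅, by simpa using h0, by simpa using by positivity, by simp⟩
  | succ j ih =>
    obtain ⟨ρ, Γ, hj, hΓ, hρ⟩ := ih
    have hmM : capturedMass (fun x => (f x : ℂ)) ρ ≤ M := capturedMass_le_wienerNorm _ ρ
    have hΓM : (#Γ : ℝ) ≤ 8192 * n ^ 2 / δ * M := hΓ.trans (by gcongr)
    set X : ℝ := 2 ^ n with hX
    have hX64 : 64 ≤ X := by
      calc (64 : ℝ) = 2 ^ 6 := by norm_num
        _ ≤ X := pow_le_pow_right₀ (by norm_num) hn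
    have hnX : (n : ℝ) ≤ X := by
      rw [hX]
      exact_mod_cast n.lt_two_pow_self.le
    have hX0 : 0 < X := by linarith
    set W : ℝ := 2 ^ ((15 * n + 4) * j) with hW
    have hW1 : 1 ≤ W := one_le_pow₀ (by norm_num)
    -- a nonzero point at which `X ^ 3 * ρ` is at most `δ / 4`
    obtain ⟨t, ht, htΓ⟩ := exists_ne_zero_charSeminorm_le Γ
      (m := 2 ^ (10 * n + (15 * n + 4) * j)) (by positivity) (by
        rw [ZMod.card]
        have h3 := hlog j #Γ (hj.trans hmM) hΓM
        have hp0 : (0 : ℝ) < p := by exact_mod_cast (Fact.out : p.Prime).pos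
        have h4 : 2 * 2 ^ (10 * n + (15 * n + 4) * j) + 1
            ≤ 2 ^ (2 + 10 * n + (15 * n + 4) * j) := by
          have h5 : 1 ≤ 2 ^ (10 * n + (15 * n + 4) * j) := Nat.one_le_two_pow
          rw [add_assoc 2, pow_add 2 2]
          omega
        refine (Nat.pow_le_pow_left h4 _).trans_lt ?_
        rw [← pow_mul]
        have h6 : ((2 ^ ((2 + 10 * n + (15 * n + 4) * j) * (2 * #Γ)) : ℕ) : ℝ) < p := by
          push_cast
          calc (2 : ℝ) ^ ((2 + 10 * n + (15 * n + 4) * j) * (2 * #Γ))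
              ≤ Real.exp 1 ^ ((2 + 10 * n + (15 * n + 4) * j) * (2 * #Γ)) := by
                gcongr
                linarith [Real.exp_one_gt_d9]
            _ = Real.exp (((2 + 10 * n + (15 * n + 4) * j) * (2 * #Γ) : ℕ) : ℝ) := by
                rw [← Real.exp_nat_mul, mul_one]
            _ < Real.exp (Real.log p) := Real.exp_lt_exp.2 h3
            _ = p := Real.exp_log hp0
        exact_mod_cast h6)
    have hτa : ∀ t, ((2 ^ n) ^ 3 • ρ) t = X ^ 3 * ρ t := fun t => by
      simp [hX]
    have hcardX : (#Γ : ℝ) ≤ X ^ 6 / 2 := by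
      have h3 : 1 / δ ≤ X / 64 := by
        rw [le_div_iff₀ (by norm_num), div_mul_eq_mul_div, one_mul]
        exact hnδ
      calc (#Γ : ℝ) ≤ 8192 * n ^ 2 / δ * M := hΓM
        _ = 8192 * n ^ 2 * (1 / δ) * M := by ring
        _ ≤ 8192 * X ^ 2 * (X / 64) * X := by gcongr
        _ = 128 * X ^ 4 := by ring
        _ ≤ X ^ 6 / 2 := by
          have h4 : (64 : ℝ) ^ 2 ≤ X ^ 2 := by gcongr
          have h5 : 0 < X ^ 4 := by positivity
          nlinarith
    have htρ : ((2 ^ n) ^ 3 • ρ) t ≤ δ / 4 := by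
      rw [hτa]
      have h3 : ((2 ^ (10 * n + (15 * n + 4) * j) : ℕ) : ℝ) = X ^ 10 * W := by
        rw [hX, hW, ← pow_mul]
        push_cast
        rw [pow_add, mul_comm 10 n]
      have h4 : ∑ χ ∈ Γ, charSeminorm χ t ≤ X ^ 6 / 2 * (2 / (X ^ 10 * W)) := by
        rw [h3] at htΓ
        refine (sum_le_card_nsmul _ _ _ htΓ).trans ?_
        rw [nsmul_eq_mul]
        gcongr
      calc X ^ 3 * ρ t ≤ X ^ 3 * (W * (X ^ 6 / 2 * (2 / (X ^ 10 * W)))) := by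
            have := hρ t
            gcongr
            exact this.trans (by gcongr)
        _ = 1 / X := by field_simp
        _ ≤ δ / 4 := by
            rw [div_le_iff₀ hδ] at hnδ
            rw [div_le_div_iff₀ hX0 (by norm_num)]
            linarith
    obtain ⟨x, hx1, hx2⟩ := exists_gibbs_average_mem ((2 ^ n) ^ 3 • ρ) habs hδ h1 h2 hα ht htρ
    obtain ⟨Λ, g, hg, hΛ, hmass⟩ := exists_capturedMass_increment hf hδ hδ1 hn hnδ
      (by rw [ZMod.card]; exact hp) hM ρ hx1 hx2
    refine ⟨(8 * (2 ^ n) ^ 15) • ρ + ∑ χ ∈ Λ, charSeminorm χ, Γ ∪ Λ, ?_, ?_, fun t => ?_⟩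
    · push_cast
      linarith
    · have h3 : (#(Γ ∪ Λ) : ℝ) ≤ #Γ + #Λ := by exact_mod_cast card_union_le Γ Λ
      refine h3.trans ((add_le_add hΓ hΛ).trans ?_)
      rw [← mul_add]
      gcongr
    · have happ : ((8 * (2 ^ n) ^ 15) • ρ + ∑ χ ∈ Λ, charSeminorm χ :
          AddGroupSeminorm (ZMod p)) t = 8 * X ^ 15 * ρ t + ∑ χ ∈ Λ, charSeminorm χ t := by
        simp [hX]
      have hW' : (2 : ℝ) ^ ((15 * n + 4) * (j + 1)) = 8 * X ^ 15 * W + 8 * X ^ 15 * W := by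
        rw [hX, hW, mul_add, pow_add, mul_one, pow_add 2 (15 * n), mul_comm 15 n, pow_mul]
        ring
      have h3 : ∑ χ ∈ Γ, charSeminorm χ t ≤ ∑ χ ∈ Γ ∪ Λ, charSeminorm χ t :=
        sum_le_sum_of_subset_of_nonneg subset_union_left fun _ _ _ => charSeminorm_nonneg _ _
      have h4 : ∑ χ ∈ Λ, charSeminorm χ t ≤ ∑ χ ∈ Γ ∪ Λ, charSeminorm χ t :=
        sum_le_sum_of_subset_of_nonneg subset_union_right fun _ _ _ => charSeminorm_nonneg _ _
      have h5 : 0 ≤ ∑ χ ∈ Γ ∪ Λ, charSeminorm χ t := sum_nonneg fun _ _ => charSeminorm_nonneg _ _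
      have h6 : 1 ≤ 8 * X ^ 15 * W := by
        have : 1 ≤ X ^ 15 := one_le_pow₀ (by linarith)
        nlinarith
      rw [happ, hW', add_mul]
      refine add_le_add ?_ (h4.trans (le_mul_of_one_le_left h5 h6))
      rw [mul_assoc _ W]
      gcongr
      exact (hρ t).trans (by gcongr)

/-- The quantitative bound in terms of a dyadic scale `2 ^ n` exceeding `log p`. -/
theorem log_le_of_wienerNorm_le {p : ℕ} [Fact p.Prime] {f : ZMod p → ℝ}
    (hf : ∀ x, f x = 0 ∨ f x = 1) {δ α : ℝ} (hδ : 0 < δ) (hδ1 : δ ≤ 1) (h1 : δ ≤ α)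
    (h2 : α ≤ 1 - δ) (hα : ∑ x, f x = p * α) {n : ℕ} (hn : 6 ≤ n) (hnδ : 64 / δ ≤ 2 ^ n)
    (hp : Real.log p ≤ 2 ^ n) (hM : wienerNorm (fun x => (f x : ℂ)) ≤ 2 ^ n)
    (hM1 : 1 ≤ wienerNorm (fun x => (f x : ℂ))) :
    Real.log p ≤ 10 ^ 9 * n ^ 3 / δ ^ 2 * wienerNorm (fun x => (f x : ℂ)) ^ 2 := by
  set M := wienerNorm (fun x => (f x : ℂ)) with hMdef
  by_contra hcon
  push Not at hcon
  have hn6 : (6 : ℝ) ≤ n := by exact_mod_cast hn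
  have hMδ : 1 ≤ M / δ := by
    rw [le_div_iff₀ hδ]
    linarith
  have hlog : ∀ j d : ℕ, j * (δ / 256) ≤ M → d ≤ 8192 * n ^ 2 / δ * M →
      ((2 + 10 * n + (15 * n + 4) * j) * (2 * d) : ℕ) < Real.log p := by
    intro j d hj hd
    refine lt_of_le_of_lt ?_ hcon
    have hj' : (j : ℝ) ≤ 256 * (M / δ) := by
      rw [← mul_div_assoc, le_div_iff₀ hδ]
      linarith
    push_cast
    calc (2 + 10 * n + (15 * n + 4) * j : ℝ) * (2 * d)
        ≤ (11 * n * (M / δ) + 16 * n * (256 * (M / δ))) * (2 * (8192 * n ^ 2 / δ * M)) := by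
          gcongr ?_ * (2 * ?_)
          refine add_le_add ?_ ?_
          · nlinarith
          · gcongr
            linarith
      _ = 67289088 * n ^ 3 / δ ^ 2 * M ^ 2 := by
          field_simp
          ring
      _ ≤ 10 ^ 9 * n ^ 3 / δ ^ 2 * M ^ 2 := by
          gcongr
          norm_num
  obtain ⟨ρ, -, hj, -⟩ := exists_capturedMass_ge hf hδ hδ1 h1 h2 hα hn hnδ hp hM hlog
    (⌊256 * (M / δ)⌋₊ + 1)
  have h3 := hj.trans (capturedMass_le_wienerNorm _ ρ)
  have h4 := Nat.lt_floor_add_one (256 * (M / δ))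
  push_cast at h3
  have h5 : 256 * (M / δ) * (δ / 256) = M := by field_simp
  have h6 := mul_lt_mul_of_pos_right h4 (show 0 < δ / 256 by positivity)
  rw [h5] at h6
  linarith

end Iteration

/-! ### The bound for dense sets modulo a prime -/

/-- The scale `2 ^ n` is taken to be the least power of two that is at least `log p`. -/
theorem log_le_of_dense {p : ℕ} [Fact p.Prime] {A : Finset (ZMod p)} {δ : ℝ} (hδ : 0 < δ)
    (h1 : δ ≤ (#A : ℝ) / p) (h2 : (#A : ℝ) / p ≤ 1 - δ) (hp : 64 / δ ≤ Real.log p)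
    (hM : wienerNorm ((A : Set (ZMod p)).indicator fun _ => (1 : ℂ)) ≤ Real.log p)
    (hM1 : 1 ≤ wienerNorm ((A : Set (ZMod p)).indicator fun _ => (1 : ℂ))) :
    Real.log p ≤ 27 * 10 ^ 9 / δ ^ 2 * Real.log (Real.log p) ^ 3 *
      wienerNorm ((A : Set (ZMod p)).indicator fun _ => (1 : ℂ)) ^ 2 := by
  classical
  set f : ZMod p → ℝ := (A : Set (ZMod p)).indicator fun _ => 1 with hf
  have hfc : (A : Set (ZMod p)).indicator (fun _ => (1 : ℂ)) = fun x => (f x : ℂ) := by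
    funext x
    simp only [hf, Set.indicator_apply]
    split_ifs <;> simp
  rw [hfc] at hM hM1 ⊢
  set L := Real.log p with hL
  have hp0 : (p : ℝ) ≠ 0 := by exact_mod_cast (Fact.out : p.Prime).ne_zero
  have hδ1 : δ ≤ 1 := by linarith
  have hL64 : 64 ≤ L := by
    refine le_trans ?_ hp
    rw [le_div_iff₀ hδ]
    linarith
  have hlogL : 4 ≤ Real.log L := by
    rw [Real.le_log_iff_exp_le (by linarith)]
    calc Real.exp 4 = Real.exp 1 ^ 4 := by rw [← Real.exp_nat_mul]; norm_num
      _ ≤ 2.7182818286 ^ 4 := by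
          gcongr
          exact Real.exp_one_lt_d9.le
      _ ≤ 64 := by norm_num
      _ ≤ L := hL64
  set n := ⌈Real.logb 2 L⌉₊ with hn
  have hLn : L ≤ 2 ^ n := by
    rw [← Real.rpow_natCast, ← Real.logb_le_iff_le_rpow (by norm_num) (by linarith)]
    exact Nat.le_ceil _
  have hn3 : (n : ℝ) ≤ 3 * Real.log L := by
    have h3 : Real.logb 2 L ≤ 2 * Real.log L := by
      rw [Real.logb, div_le_iff₀ (Real.log_pos (by norm_num))]
      have := Real.log_two_gt_d9
      nlinarith
    have h4 := Nat.ceil_lt_add_one (Real.logb_nonneg (b := 2) (by norm_num) (by linarith : 1 ≤ L))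
    linarith
  have hn6 : 6 ≤ n := by
    have h3 : (2 : ℝ) ^ 6 ≤ 2 ^ n := by
      refine le_trans ?_ hLn
      linarith
    exact (pow_le_pow_iff_right₀ (by norm_num : (1 : ℝ) < 2)).1 h3
  have hf01 : ∀ x, f x = 0 ∨ f x = 1 := fun x => by
    simp only [hf, Set.indicator_apply]
    split_ifs <;> simp
  have hsum : ∑ x, f x = p * ((#A : ℝ) / p) := by
    rw [mul_div_cancel₀ _ hp0]
    simp [hf, Set.indicator_apply]
  refine (log_le_of_wienerNorm_le hf01 hδ hδ1 h1 h2 hsum hn6 (hp.trans hLn) hLn (hM.trans hLn)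
    hM1).trans ?_
  calc 10 ^ 9 * (n : ℝ) ^ 3 / δ ^ 2 * wienerNorm (fun x => (f x : ℂ)) ^ 2
      ≤ 10 ^ 9 * (3 * Real.log L) ^ 3 / δ ^ 2 * wienerNorm (fun x => (f x : ℂ)) ^ 2 := by gcongr
    _ = _ := by ring

theorem theorem1p3 (δ : ℝ) (hδ : 0 < δ) :
    ∃ c : ℝ, 0 < c ∧ ∀ (p : ℕ) [Fact p.Prime], 3 ≤ p → ∀ A : Finset (ZMod p),
      δ ≤ (A.card : ℝ) / (p : ℝ) → (A.card : ℝ) / (p : ℝ) ≤ 1 - δ →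
        c * (Real.log (p : ℝ) / Real.log (Real.log (p : ℝ)) ^ 3) ^ (1 / 2 : ℝ) ≤
          wienerNorm ((A : Set (ZMod p)).indicator (fun _ => (1 : ℂ))) := by
  have hlog3 : 1 < Real.log 3 := by
    rw [Real.lt_log_iff_exp_lt (by norm_num)]
    linarith [Real.exp_one_lt_d9]
  set ℓ : ℝ := Real.log (Real.log 3) with hℓ
  have hℓ0 : 0 < ℓ := Real.log_pos hlog3
  -- `64 / (δ * ℓ ^ 3)` serves for `log p < 64 / δ`, and `27 * 10 ^ 9 / δ ^ 2` for larger `p`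
  set B : ℝ := max 1 (max (64 / (δ * ℓ ^ 3)) (27 * 10 ^ 9 / δ ^ 2)) with hB
  have hB1 : 1 ≤ B := le_max_left _ _
  have hB2 : 64 / (δ * ℓ ^ 3) ≤ B := (le_max_left _ _).trans (le_max_right _ _)
  have hB3 : 27 * 10 ^ 9 / δ ^ 2 ≤ B := (le_max_right _ _).trans (le_max_right _ _)
  have hsB : 0 < √B := Real.sqrt_pos.2 (by linarith)
  refine ⟨1 / √B, by positivity, fun p _ hp A h1 h2 => ?_⟩
  set M := wienerNorm ((A : Set (ZMod p)).indicator (fun _ => (1 : ℂ))) with hM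
  set L := Real.log p with hL
  have hp3 : (3 : ℝ) ≤ p := by exact_mod_cast hp
  have hL3 : Real.log 3 ≤ L := Real.log_le_log (by norm_num) hp3
  have hLℓ : ℓ ≤ Real.log L := Real.log_le_log (by linarith) hL3
  have hM1 : 1 ≤ M := by
    obtain ⟨x, hx⟩ : A.Nonempty := by
      rw [nonempty_iff_ne_empty]
      rintro rfl
      simp at h1
      linarith
    have h3 := norm_le_wienerNorm ((A : Set (ZMod p)).indicator (fun _ => (1 : ℂ))) x
    rwa [Set.indicator_of_mem (by simpa using hx), norm_one] at h3
  have hlogL0 : 0 < Real.log L := hℓ0.trans_le hLℓ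
  have key : L / Real.log L ^ 3 ≤ B * M ^ 2 := by
    rw [div_le_iff₀ (by positivity)]
    by_cases hsmall : L < 64 / δ
    · calc L ≤ 64 / δ := hsmall.le
        _ = 64 / (δ * ℓ ^ 3) * 1 * ℓ ^ 3 := by field_simp
        _ ≤ B * M ^ 2 * Real.log L ^ 3 := by
            gcongr
            exact one_le_pow₀ hM1
    push Not at hsmall
    by_cases hML : M ≤ L
    · refine (log_le_of_dense hδ h1 h2 hsmall hML hM1).trans ?_
      calc 27 * 10 ^ 9 / δ ^ 2 * Real.log L ^ 3 * M ^ 2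
          ≤ B * Real.log L ^ 3 * M ^ 2 := by gcongr
        _ = B * M ^ 2 * Real.log L ^ 3 := by ring
    · push Not at hML
      have hδ1 : δ ≤ 1 := by linarith
      have hL64 : 64 ≤ L := by
        refine le_trans ?_ hsmall
        rw [le_div_iff₀ hδ]
        linarith
      have hlogL : 1 ≤ Real.log L := by
        rw [Real.le_log_iff_exp_le (by linarith)]
        linarith [Real.exp_one_lt_d9]
      calc L ≤ M := hML.le
        _ ≤ M ^ 2 := le_self_pow₀ hM1 (by norm_num)
        _ = 1 * M ^ 2 * 1 := by ring
        _ ≤ B * M ^ 2 * Real.log L ^ 3 := by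
            gcongr
            exact one_le_pow₀ hlogL
  rw [← Real.sqrt_eq_rpow, div_mul_eq_mul_div, one_mul, div_le_iff₀ hsB]
  calc √(L / Real.log L ^ 3) ≤ √(B * M ^ 2) := Real.sqrt_le_sqrt key
    _ = M * √B := by
        rw [Real.sqrt_mul (by linarith), Real.sqrt_sq (by linarith), mul_comm]
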